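/- Let $A\in\mathbb{R}^{n\times n}$ have all its eigenvalues in the open unit disc, let $B\in\mathbb{R}^{n\times m}$ have full column rank, let $(A,B)$ be reachable, and let $G(z)=(zI-A)^{-1}B$. Let $\mathcal{S}_+^{m\times m}$ be the set of bounded and coercive spectral densities on the unit circle $\mathbb{T}$ of $\mathbb{R}^m$-valued processes, that is, of measurable $\Phi:\mathbb{T}\to\mathbb{C}^{m\times m}$ with $\Phi(\bar z)=\overline{\Phi(z)}$ and $\alpha I<\Phi(z)\le cI$ for almost every $z\in\mathbb{T}$, for some constants $\alpha,c>0$; put $G^*(z)=G(z^{-1})^\top$ (so $G^*(z)$ is the conjugate transpose of $G(z)$ on $\mathbb{T}$), and let $\Psi\in\mathcal{S}_+^{m\times m}$ be rational. The McMillan degree $\deg[M]$ of a (possibly improper) rational matrix $M$ is the number of its poles in $\mathbb{C}\cup\{\infty\}$ counted with multiplicity, the multiplicity of a pole being the highest order that it has as a pole of any minor of $M$. Then $\deg[G]=n$, and: (i) for every real symmetric $\Lambda\in\mathbb{R}^{n\times n}$ with $\Psi^{-1}+G^*\Lambda G>0$ almost everywhere on $\mathbb{T}$, the function $\Phi^\circ(\Lambda)=[\Psi^{-1}+G^*\Lambda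 G]^{-1}$ is (almost everywhere on $\mathbb{T}$ equal to) a rational matrix with $\deg[\Phi^\circ(\Lambda)]\le\deg[\Psi]+2n$; (ii) for every real symmetric $\Sigma>0$, every solution $\Phi^\circ$ of the spectrum approximation problem of minimizing $$d_{RER}(\Phi,\Psi)=\frac1{4\pi}\int_{-\pi}^{\pi}\Big\{\log\det\big(\Phi^{-1}\Psi\big)+\operatorname{tr}\big[\Psi^{-1}(\Phi-\Psi)\big]\Big\}(e^{j\vartheta})\,d\vartheta$$ over all $\Phi\in\mathcal{S}_+^{m\times m}$ with $\frac1{2\pi}\int_{-\pi}^{\pi}G\Phi G^*(e^{j\vartheta})\,d\vartheta=\Sigma$ is almost everywhere of the form $\Phi^\circ(\Lambda)$ for some $\Lambda$ as in (i), and is therefore (almost everywhere equal to) a rational matrix with $\deg[\Phi^\circ]\le\deg[\Psi]+2n$. -/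

import Mathlib

open scoped Matrix ComplexOrder
open MeasureTheory

noncomputable section

/-! ## McMillan degree of a rational matrix -/

/-- A choice of rows and columns (as many of each) in a `p × q` matrix. Non-injective choices
give a vanishing minor and permuted ones the same minor up to sign; the empty choice gives the
minor `1`. -/
abbrev MinorIndex (p q : ℕ) : Type :=
  Σ k : Fin (min p q + 1), (Fin k → Fin p) × (Fin k → Fin q)

/-- The minor of a rational matrix with the given rows and columns. -/
def ratMinor {p q : ℕ} (M : Matrix (Fin p) (Fin q) (RatFunc ℂ)) (s : MinorIndex p q) :
    RatFunc ℂ :=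
  (M.submatrix s.2.1 s.2.2).det

/-- Multiplicity of the finite point `a` as a pole of `M`: the highest order that `a` has as a
pole of a minor of `M`. -/
def poleMultiplicity {p q : ℕ} (M : Matrix (Fin p) (Fin q) (RatFunc ℂ)) (a : ℂ) : ℕ :=
  Finset.univ.sup fun s : MinorIndex p q => (ratMinor M s).denom.rootMultiplicity a

/-- Multiplicity of `∞` as a pole of `M`: the highest order that `∞` has as a pole of a minor
of `M`. -/
def poleMultiplicityInfty {p q : ℕ} (M : Matrix (Fin p) (Fin q) (RatFunc ℂ)) : ℕ :=
  Finset.univ.sup fun s : MinorIndex p q => (ratMinor M s).intDegree.toNat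

/-- McMillan degree of a (possibly improper) rational matrix: the number of its poles in
`ℂ ∪ {∞}`, counted with multiplicity. -/
def mcmillanDegree {p q : ℕ} (M : Matrix (Fin p) (Fin q) (RatFunc ℂ)) : ℕ :=
  (∑ᶠ a : ℂ, poleMultiplicity M a) + poleMultiplicityInfty M

/-- A rational matrix has finitely many poles, so the sum in its degree is a genuine one. -/
theorem poleMultiplicity_support_finite {p q : ℕ} (M : Matrix (Fin p) (Fin q) (RatFunc ℂ)) :
    (Function.support (poleMultiplicity M)).Finite := by
  classical
  refine (Finset.univ.biUnion fun s : MinorIndex p q =>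
    (ratMinor M s).denom.roots.toFinset).finite_toSet.subset ?_
  intro a ha
  by_contra h
  apply ha
  refine le_antisymm (Finset.sup_le fun s _ => ?_) (Nat.zero_le _)
  have h1 : a ∉ (ratMinor M s).denom.roots := fun h2 =>
    h (by
    rw [Finset.coe_biUnion]
    exact Set.mem_biUnion (Finset.mem_coe.2 (Finset.mem_univ s)) (by simpa using h2))
  rw [← Polynomial.count_roots]
  exact le_of_eq (Multiset.count_eq_zero.2 h1)

/-- The values on the unit circle of a rational matrix. -/
def onCircle {p q : ℕ} (M : Matrix (Fin p) (Fin q) (RatFunc ℂ)) (z : Circle) :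
    Matrix (Fin p) (Fin q) ℂ :=
  M.map (RatFunc.eval (RingHom.id ℂ) (z : ℂ))

/-! ## The filter -/

/-- The pair `(A, B)` defines a filter bank: `A` is a stability matrix, `B` has full column rank
(so `m ≤ n`), and `(A, B)` is reachable. -/
structure IsFilterBank {n m : ℕ} (A : Matrix (Fin n) (Fin n) ℝ) (B : Matrix (Fin n) (Fin m) ℝ) :
    Prop where
  stable : ∀ a : ℂ, (A.map Complex.ofReal).charpoly.IsRoot a → ‖a‖ < 1
  fullRank : B.rank = m
  reachable : Submodule.span ℝ
    (Set.range fun s : Fin n × Fin m => fun i => (A ^ (s.1 : ℕ) * B) i s.2) = ⊤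

/-- The transfer function `G(z) = (z I - A)⁻¹ B`. -/
def transferFunction {n m : ℕ} (A : Matrix (Fin n) (Fin n) ℝ) (B : Matrix (Fin n) (Fin m) ℝ) :
    Matrix (Fin n) (Fin m) (RatFunc ℂ) :=
  (Matrix.scalar (Fin n) RatFunc.X - A.map fun x => RatFunc.C (x : ℂ))⁻¹ *
    B.map fun x => RatFunc.C (x : ℂ)

/-! ## Spectral densities on the unit circle -/

/-- The property `P` holds for Lebesgue almost every point of the unit circle. -/
def AECircle (P : Circle → Prop) : Prop :=
  ∀ᵐ θ ∂(volume.restrict (Set.Ioc (-Real.pi) Real.pi)), P (Circle.exp θ)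

/-- Integral over the unit circle with respect to normalized Lebesgue measure. -/
def circleMean (f : Circle → ℂ) : ℂ :=
  (2 * (Real.pi : ℂ))⁻¹ * ∫ θ in (-Real.pi)..Real.pi, f (Circle.exp θ)

/-- The class of bounded and coercive spectral densities of `ℝ^m`-valued processes. The
symmetry `Φ (conj z) = conj (Φ z)` expresses that the process is real. -/
structure IsSpectralDensity {m : ℕ} (Φ : Circle → Matrix (Fin m) (Fin m) ℂ) : Prop where
  measurable : ∀ i j, AEMeasurable (fun θ : ℝ => Φ (Circle.exp θ) i j)
    (volume.restrict (Set.Ioc (-Real.pi) Real.pi))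
  real : AECircle fun z => Φ z⁻¹ = (Φ z).map (starRingEnd ℂ)
  bounded : ∃ c : ℝ, AECircle fun z =>
    ((c : ℂ) • (1 : Matrix (Fin m) (Fin m) ℂ) - Φ z).PosSemidef
  coercive : ∃ α : ℝ, 0 < α ∧ AECircle fun z =>
    (Φ z - (α : ℂ) • (1 : Matrix (Fin m) (Fin m) ℂ)).PosDef

/-- The relative entropy rate pseudo-distance between spectral densities. -/
def rerDist {m : ℕ} (Φ Ψ : Circle → Matrix (Fin m) (Fin m) ℂ) : ℝ :=
  (4 * Real.pi)⁻¹ * ∫ θ in (-Real.pi)..Real.pi,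
    (Real.log (((Φ (Circle.exp θ))⁻¹ * Ψ (Circle.exp θ)).det).re +
      (((Ψ (Circle.exp θ))⁻¹ * (Φ (Circle.exp θ) - Ψ (Circle.exp θ))).trace).re)

/-- The moment constraint `∫ G Φ G* = S`. -/
def MomentConstraint {n m : ℕ} (G : Circle → Matrix (Fin n) (Fin m) ℂ)
    (S : Matrix (Fin n) (Fin n) ℝ) (Φ : Circle → Matrix (Fin m) (Fin m) ℂ) : Prop :=
  ∀ i j, circleMean (fun z => (G z * Φ z * (G z)ᴴ) i j) = (S i j : ℂ)

/-- `Φ` solves the spectrum approximation problem: it minimizes `rerDist · Ψ` over the bounded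
and coercive spectral densities that satisfy the moment constraint. -/
structure IsOptimalApproximant {n m : ℕ} (G : Circle → Matrix (Fin n) (Fin m) ℂ)
    (S : Matrix (Fin n) (Fin n) ℝ) (Ψ Φ : Circle → Matrix (Fin m) (Fin m) ℂ) : Prop where
  spectral : IsSpectralDensity Φ
  moment : MomentConstraint G S Φ
  minimal : ∀ Φ' : Circle → Matrix (Fin m) (Fin m) ℂ, IsSpectralDensity Φ' →
    MomentConstraint G S Φ' → rerDist Φ Ψ ≤ rerDist Φ' Ψ

/-- The function `Ψ⁻¹ + G* Λ G` on the unit circle. -/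
def inverseApproximant {n m : ℕ} (G : Circle → Matrix (Fin n) (Fin m) ℂ)
    (Ψ : Circle → Matrix (Fin m) (Fin m) ℂ) (Λ : Matrix (Fin n) (Fin n) ℝ) (z : Circle) :
    Matrix (Fin m) (Fin m) ℂ :=
  (Ψ z)⁻¹ + (G z)ᴴ * Λ.map Complex.ofReal * G z

/-- The admissible Lagrange multipliers: real symmetric `Λ` with `Ψ⁻¹ + G* Λ G > 0` almost
everywhere on the unit circle. -/
def IsMultiplier {n m : ℕ} (G : Circle → Matrix (Fin n) (Fin m) ℂ)
    (Ψ : Circle → Matrix (Fin m) (Fin m) ℂ) (Λ : Matrix (Fin n) (Fin n) ℝ) : Prop :=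
  Λ.IsSymm ∧ AECircle fun z => (inverseApproximant G Ψ Λ z).PosDef

/-- The approximant `Φ°(Λ) = [Ψ⁻¹ + G* Λ G]⁻¹`. -/
def approximant {n m : ℕ} (G : Circle → Matrix (Fin n) (Fin m) ℂ)
    (Ψ : Circle → Matrix (Fin m) (Fin m) ℂ) (Λ : Matrix (Fin n) (Fin n) ℝ) (z : Circle) :
    Matrix (Fin m) (Fin m) ℂ :=
  (inverseApproximant G Ψ Λ z)⁻¹

/-- The function `Φ` on the unit circle is (almost everywhere) rational, with McMillan degree at
most `d`. -/
def IsRationalOfDegreeLE {m : ℕ} (Φ : Circle → Matrix (Fin m) (Fin m) ℂ) (d : ℕ) : Prop :=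
  ∃ P : Matrix (Fin m) (Fin m) (RatFunc ℂ),
    (AECircle fun z => Φ z = onCircle P z) ∧ mcmillanDegree P ≤ d

end

/-!
The pole multiplicity of a rational matrix at a place of `ℂ(z)` is the logarithm of the largest
valuation of its minors. The minors of a product are controlled by Cauchy–Binet, those of a sum by
writing it as a product of two block matrices, and the minors of `M⁻¹` are, up to the factor
`(det M)⁻¹`, complementary minors of `M`. Hence the degree is subadditive under sums and products
and, by the product formula for `det M`, invariant under inversion. For `G = (zI - A)⁻¹ B` this
gives `deg G ≤ n`, and reachability, through the Bezout identity `(zI - A) X + B Y = I`, gives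
equality; the bound on `deg Φ°(Λ)` follows.

At a minimizer `Φ` the concavity of `log det` makes `⟨Φ⁻¹ - Ψ⁻¹, D⟩ ≤ 0` for every bounded
direction `D` that preserves the moment constraint. The matrices `G* Λ G` form a finite-dimensional
space, so `Φ⁻¹ - Ψ⁻¹` has an orthogonal projection onto it; the residual preserves the constraint,
hence is itself an admissible direction, hence vanishes, and `Φ⁻¹ = Ψ⁻¹ + G* Λ G`.
-/

noncomputable section

/-! ## Minors under a valuation -/

section CauchyBinet

variable {ι κ R : Type*} [CommRing R]

theorem det_mul_eq_sum_prod_mul_det [Fintype ι] [DecidableEq ι] [Fintype κ]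
    (M : Matrix ι κ R) (N : Matrix κ ι R) :
    (M * N).det = ∑ t : ι → κ, (∏ i, M i (t i)) * (N.submatrix t id).det := by
  have rows : M * N = fun i => ∑ j, M i j • N j := by
    ext i j
    simp [Matrix.mul_apply]
  rw [rows]
  refine (Matrix.detRowAlternating.toMultilinearMap.map_sum fun i j => M i j • N j).trans
    (Finset.sum_congr rfl fun t _ => ?_)
  exact Matrix.detRowAlternating.toMultilinearMap.map_smul_univ _ _

theorem det_mul_det_eq_sum_perm [Fintype ι] [DecidableEq ι] (M : Matrix ι ι R)
    (N : Matrix ι ι R) :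
    M.det * N.det = ∑ σ : Equiv.Perm ι, (∏ i, M i (σ i)) * (N.submatrix σ id).det := by
  rw [← M.det_transpose, Matrix.det_apply', Finset.sum_mul]
  refine Finset.sum_congr rfl fun σ _ => ?_
  rw [Matrix.det_permute]
  simp only [Matrix.transpose_apply]
  ring

/-- The **Cauchy–Binet formula**. -/
theorem det_mul_eq_sum_orderEmbedding [Fintype κ] [LinearOrder κ] {r : ℕ}
    (M : Matrix (Fin r) κ R) (N : Matrix κ (Fin r) R) :
    (M * N).det =
      ∑ e : Fin r ↪o κ, (M.submatrix id e).det * (N.submatrix e id).det := by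
  simp_rw [det_mul_eq_sum_prod_mul_det M N, det_mul_det_eq_sum_perm (M.submatrix id _),
    Matrix.submatrix_submatrix, Function.comp_id]
  rw [← Fintype.sum_prod_type']
  symm
  refine Finset.sum_of_injOn (fun p : (Fin r ↪o κ) × Equiv.Perm (Fin r) => p.1 ∘ p.2)
    ?_ (by simp) ?_ (by simp)
  · rintro ⟨e, σ⟩ - ⟨e', σ'⟩ - (h : e ∘ σ = e' ∘ σ')
    have hrange : Set.range e = Set.range e' := by
      rw [← σ.surjective.range_comp, h, σ'.surjective.range_comp]
    obtain rfl : e = e' :=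
      DFunLike.coe_injective ((e.strictMono.range_inj e'.strictMono).1 hrange)
    exact congrArg (Prod.mk e) (Equiv.ext fun i => e.injective (congrFun h i))
  · intro t _ ht
    suffices ¬ Function.Injective t by
      obtain ⟨i, j, hij, hne⟩ := Function.not_injective_iff.1 this
      rw [Matrix.det_zero_of_row_eq hne (by ext; simp [hij]), mul_zero]
    intro hinj
    refine ht ⟨⟨OrderEmbedding.ofStrictMono _ ((Tuple.monotone_sort t).strictMono_of_injective
      (hinj.comp (Tuple.sort t).injective)), (Tuple.sort t)⁻¹⟩, by simp, ?_⟩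
    ext i
    simp

end CauchyBinet

theorem valuation_det_le_pow {R Γ₀ n : Type*} [CommRing R] [LinearOrderedCommMonoidWithZero Γ₀]
    {v : Valuation R Γ₀} {δ : Γ₀} [Fintype n] [DecidableEq n] {M : Matrix n n R}
    (h : ∀ i j, v (M i j) ≤ δ) : v M.det ≤ δ ^ Fintype.card n := by
  rw [Matrix.det_apply']
  refine v.map_sum_le fun σ _ => ?_
  have hsign : v (Equiv.Perm.sign σ : ℤ) = 1 := by
    rcases Int.units_eq_one_or (Equiv.Perm.sign σ) with hσ | hσ <;> simp [hσ]
  rw [map_mul, hsign, one_mul, map_prod]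
  exact (Finset.prod_le_pow_card _ _ _ fun i _ => h _ _).trans_eq (by simp)

/-- All minors of `M`, the empty one included, have valuation at most `γ`. For the valuation of a
place `x` of `ℂ(z)` and `γ = exp k` this says that `x` is a pole of `M` of multiplicity at most
`k`. Rows and columns may be repeated, which only adds vanishing minors and permutes the others. -/
def MinorsLE {R Γ₀ P Q : Type*} [CommRing R] [LinearOrderedCommMonoidWithZero Γ₀]
    (v : Valuation R Γ₀) (γ : Γ₀) (M : Matrix P Q R) : Prop :=
  ∀ (r : ℕ) (s : Fin r → P) (t : Fin r → Q), v (M.submatrix s t).det ≤ γ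

namespace MinorsLE

section Ring

variable {R Γ₀ P Q S : Type*} [CommRing R] [LinearOrderedCommMonoidWithZero Γ₀]
  {v : Valuation R Γ₀} {γ δ : Γ₀} {M : Matrix P Q R}

theorem one_le (h : MinorsLE v γ M) : 1 ≤ γ := by
  simpa using h 0 Fin.elim0 Fin.elim0

theorem submatrix (h : MinorsLE v γ M) {P' Q' : Type*} (s : P' → P) (t : Q' → Q) :
    MinorsLE v γ (M.submatrix s t) :=
  fun r s' t' => h r (s ∘ s') (t ∘ t')

theorem transpose (h : MinorsLE v γ M) : MinorsLE v γ Mᵀ := fun r s t => by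
  rw [← Matrix.transpose_submatrix, Matrix.det_transpose]
  exact h r t s

theorem valuation_det_submatrix_le (h : MinorsLE v γ M) {ι : Type*} [Fintype ι] [DecidableEq ι]
    (s : ι → P) (t : ι → Q) : v (M.submatrix s t).det ≤ γ := by
  let e := Fintype.equivFin ι
  rw [← Matrix.det_submatrix_equiv_self e.symm, Matrix.submatrix_submatrix]
  exact h _ _ _

theorem of_injective (h : ∀ (r : ℕ) (s : Fin r → P) (t : Fin r → Q), Function.Injective s →
    Function.Injective t → v (M.submatrix s t).det ≤ γ) : MinorsLE v γ M := by
  intro r s t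
  by_cases hs : Function.Injective s
  · by_cases ht : Function.Injective t
    · exact h r s t hs ht
    · obtain ⟨i, j, hij, hne⟩ := Function.not_injective_iff.1 ht
      rw [Matrix.det_zero_of_column_eq hne (by simp [hij]), map_zero]
      exact zero_le
  · obtain ⟨i, j, hij, hne⟩ := Function.not_injective_iff.1 hs
    rw [Matrix.det_zero_of_row_eq hne (by ext; simp [hij]), map_zero]
    exact zero_le

theorem of_entries_le [Fintype P] (hδ : 1 ≤ δ) (h : ∀ i j, v (M i j) ≤ δ) :
    MinorsLE v (δ ^ Fintype.card P) M := by
  refine of_injective fun r s t hs _ => ?_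
  refine (valuation_det_le_pow fun i j => h (s i) (t j)).trans (pow_le_pow_right₀ hδ ?_)
  exact Fintype.card_le_of_injective s hs

theorem of_entries_le_one (h : ∀ i j, v (M i j) ≤ 1) : MinorsLE v 1 M := fun r s t => by
  simpa using valuation_det_le_pow (M := M.submatrix s t) fun i j => h (s i) (t j)

theorem mul [Fintype Q] {N : Matrix Q S R} (hM : MinorsLE v γ M) (hN : MinorsLE v δ N) :
    MinorsLE v (γ * δ) (M * N) := by
  intro r s t
  let e := (Fintype.equivFin Q).symm
  rw [← Matrix.submatrix_mul_equiv M N s e t, det_mul_eq_sum_orderEmbedding]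
  refine v.map_sum_le fun c _ => ?_
  rw [map_mul]
  exact mul_le_mul' (hM r s (e ∘ c)) (hN r (e ∘ c) t)

/-- Laplace expansion along a column of the identity block. -/
theorem fromCols_one [DecidableEq P] (h : MinorsLE v γ M) :
    MinorsLE v γ (Matrix.fromCols (1 : Matrix P P R) M) := by
  intro r
  induction r with
  | zero => simpa using h.one_le
  | succ r ih =>
    intro s t
    by_cases ht : ∃ j k, t j = Sum.inl k
    · obtain ⟨j, k, hjk⟩ := ht
      rw [Matrix.det_succ_column _ j]
      refine v.map_sum_le fun i _ => ?_
      have hentry : v ((Matrix.fromCols 1 M).submatrix s t i j) ≤ 1 := by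
        by_cases hik : s i = k <;> simp [hjk, hik]
      have hminor := ih (s ∘ i.succAbove) (t ∘ j.succAbove)
      simpa using mul_le_mul' hentry hminor
    · push Not at ht
      have hr (j : Fin (r + 1)) : ∃ q, t j = Sum.inr q := by
        rcases htj : t j with k | q
        · exact absurd htj (ht j k)
        · exact ⟨q, rfl⟩
      choose q hq using hr
      obtain rfl : t = Sum.inr ∘ q := funext hq
      exact h _ s q

theorem fromCols_comm {N : Matrix P S R} (h : MinorsLE v γ (Matrix.fromCols M N)) :
    MinorsLE v γ (Matrix.fromCols N M) := by
  convert! h.submatrix id Sum.swap using 1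
  ext i (j | j) <;> rfl

theorem add {N : Matrix P Q R} (hM : MinorsLE v γ M) (hN : MinorsLE v δ N) :
    MinorsLE v (γ * δ) (M + N) := by
  intro r s t
  have hcols := (hM.submatrix s t).fromCols_one.fromCols_comm
  have hrows := (hN.submatrix s t).transpose.fromCols_one.transpose
  rw [Matrix.transpose_fromCols, Matrix.transpose_one, Matrix.transpose_transpose] at hrows
  simpa [Matrix.fromCols_mul_fromRows, Matrix.submatrix_add] using (hcols.mul hrows) r id id

/-- A minor of `M` is, up to sign, the maximal minor of `[1 M]` that replaces the rows it uses. -/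
theorem of_fromCols_one [Fintype P] [DecidableEq P]
    (h : ∀ t : P → P ⊕ Q, v ((Matrix.fromCols (1 : Matrix P P R) M).submatrix id t).det ≤ γ) :
    MinorsLE v γ M := by
  refine of_injective fun r s t hs _ => ?_
  let t' : P → P ⊕ Q := Function.extend s (Sum.inr ∘ t) Sum.inl
  let K := (Matrix.fromCols (1 : Matrix P P R) M).submatrix id t'
  have outside {j : P} (hj : j ∉ Set.range s) : t' j = Sum.inl j :=
    Function.extend_apply' _ _ _ hj
  have inside (k : Fin r) : t' (s k) = Sum.inr (t k) := hs.extend_apply _ _ k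
  have triangular : ∀ i ∈ Set.range s, ∀ j ∉ Set.range s, K i j = 0 := by
    intro i hi j hj
    have hij : i ≠ j := fun hij => hj (hij ▸ hi)
    simp [K, outside hj, hij]
  have corner : K.toSquareBlockProp (· ∉ Set.range s) = 1 := by
    ext i j
    simp [K, Matrix.toSquareBlockProp, outside j.2, Matrix.one_apply, Subtype.ext_iff]
  have minor : (K.toSquareBlockProp (· ∈ Set.range s)).submatrix (Equiv.ofInjective s hs)
      (Equiv.ofInjective s hs) = M.submatrix s t := by
    ext i j
    simp [K, Matrix.toSquareBlockProp, inside]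
  have hK : K.det = (M.submatrix s t).det := by
    classical
    rw [Matrix.twoBlockTriangular_det' K (· ∈ Set.range s) triangular, corner, Matrix.det_one,
      mul_one, ← minor, Matrix.det_submatrix_equiv_self]
    congr!
  exact hK ▸ h t'

end Ring

theorem inv {R Γ₀ P : Type*} [CommRing R] [LinearOrderedCommGroupWithZero Γ₀]
    {v : Valuation R Γ₀} {γ : Γ₀} [Fintype P] [DecidableEq P] {M : Matrix P P R}
    (hM : MinorsLE v γ M) (hdet : IsUnit M.det) : MinorsLE v ((v M.det)⁻¹ * γ) M⁻¹ := by
  have hblocks : Matrix.fromCols 1 M⁻¹ = M⁻¹ * Matrix.fromCols M 1 := by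
    rw [Matrix.mul_fromCols, M.nonsing_inv_mul hdet, mul_one]
  have hval : v M⁻¹.det = (v M.det)⁻¹ := by
    refine eq_inv_of_mul_eq_one_left ?_
    rw [← map_mul, ← Matrix.det_mul, M.nonsing_inv_mul hdet, Matrix.det_one, map_one]
  refine of_fromCols_one fun t => ?_
  rw [hblocks, ← Matrix.submatrix_mul_equiv M⁻¹ _ id (Equiv.refl P) t, Matrix.det_mul, map_mul]
  exact mul_le_mul' hval.le
    (hM.fromCols_one.fromCols_comm.valuation_det_submatrix_le id t)

end MinorsLE

/-! ## The places of `ℂ(z)` -/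

section Places

open Polynomial WithZero

theorem hasFiniteSupport_rootMultiplicity (p : ℂ[X]) :
    (p.rootMultiplicity ·).HasFiniteSupport := by
  classical
  simpa only [count_roots] using Multiset.hasFiniteSupport_count p.roots

theorem finsum_rootMultiplicity (p : ℂ[X]) : ∑ᶠ a, p.rootMultiplicity a = p.natDegree := by
  classical
  simp_rw [← count_roots]
  rw [finsum_eq_sum_of_support_subset (s := p.roots.toFinset) _ fun a ha =>
    Multiset.mem_toFinset.2 (Multiset.count_ne_zero.1 ha), Multiset.toFinset_sum_count_eq]
  exact (IsAlgClosed.splits p).natDegree_eq_card_roots.symm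

/-- The order of `x`, a point of `ℂ ∪ {∞}` with `none` standing for `∞`, as a pole of the rational
function `f`. It is negative if `x` is a zero of `f`, and `0` for `f = 0`. -/
def poleOrder (x : Option ℂ) (f : RatFunc ℂ) : ℤ :=
  x.elim f.intDegree fun a => f.denom.rootMultiplicity a - f.num.rootMultiplicity a

theorem toNat_poleOrder_some (a : ℂ) (f : RatFunc ℂ) :
    (poleOrder (some a) f).toNat = f.denom.rootMultiplicity a := by
  by_cases hd : f.denom.IsRoot a
  · have hn : ¬ f.num.IsRoot a := fun hn => by
      obtain ⟨u, v, huv⟩ := f.isCoprime_num_denom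
      simpa [hn.eq_zero, hd.eq_zero] using congrArg (eval a) huv
    simp [poleOrder, rootMultiplicity_eq_zero hn]
  · simp [poleOrder, rootMultiplicity_eq_zero hd]

theorem hasFiniteSupport_poleOrder (f : RatFunc ℂ) : (poleOrder · f).HasFiniteSupport :=
  Set.finite_option.2 <|
    ((hasFiniteSupport_rootMultiplicity f.denom).fun_comp Nat.cast_zero).sub
      ((hasFiniteSupport_rootMultiplicity f.num).fun_comp Nat.cast_zero)

/-- The divisor of a rational function has degree zero. -/
theorem finsum_poleOrder (f : RatFunc ℂ) : ∑ᶠ x, poleOrder x f = 0 := by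
  have cast_finsum (p : ℂ[X]) : ∑ᶠ a, (p.rootMultiplicity a : ℤ) = p.natDegree := by
    rw [← finsum_rootMultiplicity]
    exact ((Nat.castAddMonoidHom ℤ).map_finsum (hasFiniteSupport_rootMultiplicity p)).symm
  have finite_part : ∑ᶠ a : ℂ, poleOrder (some a) f = f.denom.natDegree - f.num.natDegree := by
    rw [← cast_finsum, ← cast_finsum]
    exact finsum_sub_distrib ((hasFiniteSupport_rootMultiplicity _).fun_comp Nat.cast_zero)
      ((hasFiniteSupport_rootMultiplicity _).fun_comp Nat.cast_zero)
  rw [finsum_option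
    ((hasFiniteSupport_poleOrder f).comp_of_injective (Option.some_injective ℂ)), finite_part]
  simp [poleOrder, RatFunc.intDegree]

/-- The prime ideal `(z - a)` of `ℂ[z]`. -/
def linearPrime (a : ℂ) : IsDedekindDomain.HeightOneSpectrum ℂ[X] :=
  .ofPrime (Ideal.prime_span_singleton_iff.2 (prime_X_sub_C a))

theorem intValuation_linearPrime {p : ℂ[X]} (hp : p ≠ 0) (a : ℂ) :
    (linearPrime a).intValuation p = exp (-(p.rootMultiplicity a : ℤ)) := by
  classical
  rw [IsDedekindDomain.HeightOneSpectrum.intValuation_eq_exp_neg_multiplicity _ hp,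
    rootMultiplicity_eq_multiplicity, if_neg hp]
  congr 3
  exact multiplicity_eq_of_emultiplicity_eq Ideal.emultiplicity_eq_emultiplicity_span

open Classical in
/-- The valuation of the place `x` of `ℂ(z)`, with `none` standing for `∞`. -/
def placeValuation (x : Option ℂ) : Valuation (RatFunc ℂ) ℤᵐ⁰ :=
  x.elim (RatFunc.inftyValuation ℂ) fun a => (linearPrime a).valuation (RatFunc ℂ)

theorem placeValuation_algebraMap {p : ℂ[X]} (hp : p ≠ 0) (a : ℂ) :
    placeValuation (some a) (algebraMap ℂ[X] (RatFunc ℂ) p) = exp (-(p.rootMultiplicity a : ℤ)) :=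
  ((linearPrime a).valuation_of_algebraMap p).trans (intValuation_linearPrime hp a)

theorem placeValuation_eq_exp_poleOrder (x : Option ℂ) {f : RatFunc ℂ} (hf : f ≠ 0) :
    placeValuation x f = exp (poleOrder x f) := by
  classical
  cases x with
  | none => exact RatFunc.inftyValuation_of_nonzero ℂ hf
  | some a =>
    conv_lhs => rw [← f.num_div_denom]
    rw [map_div₀, placeValuation_algebraMap (RatFunc.num_ne_zero hf),
      placeValuation_algebraMap f.denom_ne_zero, ← exp_sub, neg_sub_neg]
    rfl

theorem placeValuation_le_exp_natCast_iff {x : Option ℂ} {f : RatFunc ℂ} {k : ℕ} :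
    placeValuation x f ≤ exp (k : ℤ) ↔ (poleOrder x f).toNat ≤ k := by
  by_cases hf : f = 0
  · cases x <;> simp [hf, poleOrder, rootMultiplicity_eq_zero]
  · rw [placeValuation_eq_exp_poleOrder x hf, exp_le_exp, Int.toNat_le]

theorem placeValuation_C_le_one (x : Option ℂ) (c : ℂ) : placeValuation x (RatFunc.C c) ≤ 1 := by
  rw [← exp_zero, ← Nat.cast_zero, placeValuation_le_exp_natCast_iff]
  cases x <;> simp [poleOrder, rootMultiplicity_eq_zero]

theorem one_le_exp_natCast (k : ℕ) : (1 : ℤᵐ⁰) ≤ exp (k : ℤ) := by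
  rw [← exp_zero, exp_le_exp]
  positivity

theorem MinorsLE.map_C (x : Option ℂ) {P Q : Type*} (M : Matrix P Q ℂ) :
    MinorsLE (placeValuation x) 1 (M.map RatFunc.C) :=
  .of_entries_le_one fun _ _ => placeValuation_C_le_one x _

end Places

/-! ## Arithmetic of the McMillan degree -/

section McMillanDegree

open WithZero

variable {p q r : ℕ} {x : Option ℂ}

/-- The multiplicity of `x`, a point of `ℂ ∪ {∞}` with `none` standing for `∞`, as a pole of `M`:
the common notation for `poleMultiplicity` and `poleMultiplicityInfty`. -/
def poleDegree (x : Option ℂ) (M : Matrix (Fin p) (Fin q) (RatFunc ℂ)) : ℕ :=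
  x.elim (poleMultiplicityInfty M) (poleMultiplicity M)

theorem poleDegree_eq_sup (x : Option ℂ) (M : Matrix (Fin p) (Fin q) (RatFunc ℂ)) :
    poleDegree x M = Finset.univ.sup fun s => (poleOrder x (ratMinor M s)).toNat := by
  cases x with
  | none => rfl
  | some a => simp only [toNat_poleOrder_some, poleDegree, Option.elim_some, poleMultiplicity]

theorem minorsLE_exp_iff_poleDegree_le {M : Matrix (Fin p) (Fin q) (RatFunc ℂ)} {k : ℕ} :
    MinorsLE (placeValuation x) (exp (k : ℤ)) M ↔ poleDegree x M ≤ k := by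
  rw [poleDegree_eq_sup, Finset.sup_le_iff]
  refine ⟨fun h s _ => placeValuation_le_exp_natCast_iff.1 (h _ _ _),
    fun h => .of_injective fun r s t hs ht => ?_⟩
  have hr : r ≤ min p q := le_min (by simpa using Fintype.card_le_of_injective s hs)
    (by simpa using Fintype.card_le_of_injective t ht)
  exact placeValuation_le_exp_natCast_iff.2
    (h ⟨⟨r, Nat.lt_succ_of_le hr⟩, s, t⟩ (Finset.mem_univ _))

theorem minorsLE_exp_poleDegree (x : Option ℂ) (M : Matrix (Fin p) (Fin q) (RatFunc ℂ)) :
    MinorsLE (placeValuation x) (exp (poleDegree x M : ℤ)) M :=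
  minorsLE_exp_iff_poleDegree_le.2 le_rfl

theorem poleDegree_add_le (x : Option ℂ) (M N : Matrix (Fin p) (Fin q) (RatFunc ℂ)) :
    poleDegree x (M + N) ≤ poleDegree x M + poleDegree x N := by
  rw [← minorsLE_exp_iff_poleDegree_le, Nat.cast_add, exp_add]
  exact (minorsLE_exp_poleDegree x M).add (minorsLE_exp_poleDegree x N)

theorem poleDegree_mul_le (x : Option ℂ) (M : Matrix (Fin p) (Fin q) (RatFunc ℂ))
    (N : Matrix (Fin q) (Fin r) (RatFunc ℂ)) :
    poleDegree x (M * N) ≤ poleDegree x M + poleDegree x N := by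
  rw [← minorsLE_exp_iff_poleDegree_le, Nat.cast_add, exp_add]
  exact (minorsLE_exp_poleDegree x M).mul (minorsLE_exp_poleDegree x N)

theorem poleDegree_inv_add_poleOrder_det_le (x : Option ℂ)
    {M : Matrix (Fin p) (Fin p) (RatFunc ℂ)} (hM : M.det ≠ 0) :
    poleDegree x M⁻¹ + poleOrder x M.det ≤ poleDegree x M := by
  have hinv := (minorsLE_exp_poleDegree x M).inv hM.isUnit
  rw [placeValuation_eq_exp_poleOrder x hM, ← exp_neg, ← exp_add] at hinv
  obtain ⟨k, hk⟩ := Int.eq_ofNat_of_zero_le (exp_le_exp.1 (exp_zero.trans_le hinv.one_le))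
  rw [hk] at hinv
  have := minorsLE_exp_iff_poleDegree_le.1 hinv
  lia

theorem poleDegree_map_C (x : Option ℂ) (M : Matrix (Fin p) (Fin q) ℂ) :
    poleDegree x (M.map RatFunc.C) = 0 :=
  Nat.le_zero.1 (minorsLE_exp_iff_poleDegree_le.1 (by simpa using MinorsLE.map_C x M))

theorem hasFiniteSupport_poleDegree (M : Matrix (Fin p) (Fin q) (RatFunc ℂ)) :
    (poleDegree · M).HasFiniteSupport :=
  Set.finite_option.2 (poleMultiplicity_support_finite M)

theorem mcmillanDegree_eq_finsum (M : Matrix (Fin p) (Fin q) (RatFunc ℂ)) :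
    mcmillanDegree M = ∑ᶠ x, poleDegree x M :=
  (add_comm _ _).trans
    (finsum_option (f := (poleDegree · M)) (poleMultiplicity_support_finite M)).symm

theorem mcmillanDegree_add_le (M N : Matrix (Fin p) (Fin q) (RatFunc ℂ)) :
    mcmillanDegree (M + N) ≤ mcmillanDegree M + mcmillanDegree N := by
  have hM := hasFiniteSupport_poleDegree M
  have hN := hasFiniteSupport_poleDegree N
  simp_rw [mcmillanDegree_eq_finsum]
  rw [← finsum_add_distrib hM hN]
  exact finsum_le_finsum' (hasFiniteSupport_poleDegree _) (hM.add hN)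
    fun x => poleDegree_add_le x M N

theorem mcmillanDegree_mul_le (M : Matrix (Fin p) (Fin q) (RatFunc ℂ))
    (N : Matrix (Fin q) (Fin r) (RatFunc ℂ)) :
    mcmillanDegree (M * N) ≤ mcmillanDegree M + mcmillanDegree N := by
  have hM := hasFiniteSupport_poleDegree M
  have hN := hasFiniteSupport_poleDegree N
  simp_rw [mcmillanDegree_eq_finsum]
  rw [← finsum_add_distrib hM hN]
  exact finsum_le_finsum' (hasFiniteSupport_poleDegree _) (hM.add hN)
    fun x => poleDegree_mul_le x M N

theorem mcmillanDegree_map_C (M : Matrix (Fin p) (Fin q) ℂ) :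
    mcmillanDegree (M.map RatFunc.C) = 0 := by
  simp [mcmillanDegree_eq_finsum, poleDegree_map_C]

/-- The bounds at the single places add up, since `det M` has as many zeros as poles. -/
theorem mcmillanDegree_inv_le (M : Matrix (Fin p) (Fin p) (RatFunc ℂ)) :
    mcmillanDegree M⁻¹ ≤ mcmillanDegree M := by
  by_cases hM : M.det = 0
  · have hzero : M⁻¹ = (0 : Matrix (Fin p) (Fin p) ℂ).map RatFunc.C := by
      rw [Matrix.nonsing_inv_apply_not_isUnit _ (by simp [hM]), Matrix.map_zero _ (map_zero _)]
    rw [hzero, mcmillanDegree_map_C]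
    exact Nat.zero_le _
  have cast_degree (N : Matrix (Fin p) (Fin p) (RatFunc ℂ)) :
      (mcmillanDegree N : ℤ) = ∑ᶠ x, (poleDegree x N : ℤ) := by
    rw [mcmillanDegree_eq_finsum]
    exact (Nat.castAddMonoidHom ℤ).map_finsum (hasFiniteSupport_poleDegree N)
  have hinv := (hasFiniteSupport_poleDegree M⁻¹).fun_comp (Nat.cast_zero (R := ℤ))
  have hdet := hasFiniteSupport_poleOrder M.det
  zify
  rw [← add_zero (mcmillanDegree M⁻¹ : ℤ), ← finsum_poleOrder M.det, cast_degree, cast_degree,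
    ← finsum_add_distrib hinv hdet]
  exact finsum_le_finsum' (hinv.add hdet)
    ((hasFiniteSupport_poleDegree M).fun_comp Nat.cast_zero)
    fun x => poleDegree_inv_add_poleOrder_det_le x hM

theorem mcmillanDegree_scalar_sub_map_C_le {f : RatFunc ℂ} (hx : placeValuation x f ≤ exp 1)
    (hf : ∀ y ≠ x, placeValuation y f ≤ 1) (A : Matrix (Fin p) (Fin p) ℂ) :
    mcmillanDegree (Matrix.scalar (Fin p) f - A.map RatFunc.C) ≤ p := by
  classical
  have entry {y : Option ℂ} {γ : ℤᵐ⁰} (hγ : 1 ≤ γ) (hy : placeValuation y f ≤ γ) (i j : Fin p) :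
      placeValuation y ((Matrix.scalar (Fin p) f - A.map RatFunc.C) i j) ≤ γ := by
    refine Valuation.map_sub_le _ ?_ ((placeValuation_C_le_one y _).trans hγ)
    by_cases hij : i = j <;> simp [hij, hy]
  have pole : poleDegree x (Matrix.scalar (Fin p) f - A.map RatFunc.C) ≤ p := by
    have := MinorsLE.of_entries_le (one_le_exp_natCast 1) (entry (one_le_exp_natCast 1) hx)
    rw [← minorsLE_exp_iff_poleDegree_le]
    simpa [← exp_nsmul] using this
  have no_pole {y : Option ℂ} (hy : y ≠ x) :
      poleDegree y (Matrix.scalar (Fin p) f - A.map RatFunc.C) = 0 := by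
    rw [← Nat.le_zero, ← minorsLE_exp_iff_poleDegree_le, Nat.cast_zero, exp_zero]
    exact .of_entries_le_one (entry le_rfl (hf y hy))
  rwa [mcmillanDegree_eq_finsum, finsum_eq_single _ x fun y => no_pole]

theorem placeValuation_X_le_one (a : ℂ) : placeValuation (some a) RatFunc.X ≤ 1 := by
  rw [← exp_zero, ← Nat.cast_zero, placeValuation_le_exp_natCast_iff, toNat_poleOrder_some]
  simp [Polynomial.rootMultiplicity_eq_zero]

theorem mcmillanDegree_X_sub_map_C_le (A : Matrix (Fin p) (Fin p) ℂ) :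
    mcmillanDegree (Matrix.scalar (Fin p) RatFunc.X - A.map RatFunc.C) ≤ p := by
  refine mcmillanDegree_scalar_sub_map_C_le (x := none) ?_ (fun y hy => ?_) A
  · classical exact (RatFunc.inftyValuation.X ℂ).le
  · obtain ⟨a, rfl⟩ := Option.ne_none_iff_exists'.1 hy
    exact placeValuation_X_le_one a

theorem poleOrder_some_X (a : ℂ) :
    poleOrder (some a) RatFunc.X = -(Polynomial.X.rootMultiplicity a : ℤ) := by
  simp [poleOrder, Polynomial.rootMultiplicity_eq_zero]

theorem mcmillanDegree_X_inv_sub_map_C_le (A : Matrix (Fin p) (Fin p) ℂ) :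
    mcmillanDegree (Matrix.scalar (Fin p) RatFunc.X⁻¹ - A.map RatFunc.C) ≤ p := by
  have valuation_X_inv (y : Option ℂ) :
      placeValuation y RatFunc.X⁻¹ = exp (-poleOrder y RatFunc.X) := by
    rw [map_inv₀, placeValuation_eq_exp_poleOrder y RatFunc.X_ne_zero, exp_neg]
  refine mcmillanDegree_scalar_sub_map_C_le (x := some 0) ?_ (fun y hy => ?_) A
  · rw [valuation_X_inv, poleOrder_some_X, neg_neg, exp_le_exp]
    simpa using (Polynomial.rootMultiplicity_X_sub_C_self (x := (0 : ℂ))).le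
  · rw [valuation_X_inv, ← exp_zero, exp_le_exp]
    cases y with
    | none => simp [poleOrder]
    | some a =>
      have ha : a ≠ 0 := fun h => hy (congrArg some h)
      rw [poleOrder_some_X, Polynomial.rootMultiplicity_eq_zero (by simpa using ha)]
      simp

end McMillanDegree

/-! ## The degree of the transfer function -/

section TransferFunction

open Polynomial

theorem exists_sum_pow_mul_mul_eq_one {R ι κ : Type*} [CommRing R] [Fintype ι] [DecidableEq ι]
    [Fintype κ] {N : ℕ} {A : Matrix ι ι R} {B : Matrix ι κ R}
    (h : Submodule.span R (Set.range fun s : Fin N × κ => fun i => (A ^ (s.1 : ℕ) * B) i s.2) = ⊤) :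
    ∃ K : Fin N → Matrix κ ι R, ∑ k : Fin N, A ^ (k : ℕ) * B * K k = 1 := by
  have combination (j : ι) : ∃ c : Fin N × κ → R,
      ∑ s, c s • (fun i => (A ^ (s.1 : ℕ) * B) i s.2) = Pi.single j 1 :=
    (Submodule.mem_span_range_iff_exists_fun R).1 (h ▸ Submodule.mem_top)
  choose c hc using combination
  refine ⟨fun k => Matrix.of fun l j => c j (k, l), ?_⟩
  ext i j
  rw [Matrix.one_apply, ← Pi.single_apply, ← hc j]
  simp [Matrix.sum_apply, Matrix.mul_apply (N := Matrix.of _), Fintype.sum_prod_type, mul_comm]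

/-- The Popov–Belevitch–Hautus form of reachability. -/
theorem exists_charmatrix_mul_add_mul_eq_one {R ι κ : Type*} [CommRing R] [Fintype ι]
    [DecidableEq ι] [Fintype κ] {N : ℕ} {A : Matrix ι ι R} {B : Matrix ι κ R}
    {K : Fin N → Matrix κ ι R} (hK : ∑ k : Fin N, A ^ (k : ℕ) * B * K k = 1) :
    ∃ (U : Matrix ι ι R[X]) (V : Matrix κ ι R[X]), A.charmatrix * U + B.map C * V = 1 := by
  let quotient (k : ℕ) : Matrix ι ι R[X] :=
    ∑ i ∈ Finset.range k, Matrix.scalar ι X ^ i * A.map C ^ (k - 1 - i)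
  have geom_sum (k : ℕ) : A.charmatrix * quotient k = Matrix.scalar ι (X ^ k) - (A ^ k).map C := by
    rw [map_pow, ← RingHom.mapMatrix_apply, map_pow]
    exact (Matrix.scalar_commute X (fun _ => Commute.all _ _) _).mul_geom_sum₂ k
  have term (k : Fin N) : A.charmatrix * -(quotient k * (B * K k).map C) +
      B.map C * ((X ^ (k : ℕ) : R[X]) • (K k).map C) =
        (A ^ (k : ℕ) * B * K k).map C := by
    rw [mul_neg, ← mul_assoc, geom_sum, sub_mul, neg_sub, Matrix.mul_smul, ← Matrix.map_mul,
      ← Matrix.map_mul, Matrix.scalar_apply, ← Matrix.smul_eq_diagonal_mul, Matrix.mul_assoc]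
    exact sub_add_cancel _ _
  refine ⟨∑ k : Fin N, -(quotient k * (B * K k).map C),
    ∑ k : Fin N, (X ^ (k : ℕ) : R[X]) • (K k).map C, ?_⟩
  rw [Matrix.mul_sum, Matrix.mul_sum, ← Finset.sum_add_distrib]
  simp_rw [term, ← RingHom.mapMatrix_apply]
  rw [← map_sum, hK, map_one]

theorem map_charmatrix {K ι : Type*} [Field K] [Fintype ι] [DecidableEq ι] (A : Matrix ι ι K) :
    A.charmatrix.map (algebraMap K[X] (RatFunc K)) =
      Matrix.scalar ι RatFunc.X - A.map RatFunc.C := by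
  ext i j
  by_cases h : i = j <;> simp [h, RatFunc.algebraMap_C]

variable {n m : ℕ} {A : Matrix (Fin n) (Fin n) ℝ} {B : Matrix (Fin n) (Fin m) ℝ}

theorem transferFunction_eq (A : Matrix (Fin n) (Fin n) ℝ) (B : Matrix (Fin n) (Fin m) ℝ) :
    transferFunction A B =
      (Matrix.scalar (Fin n) RatFunc.X - (A.map Complex.ofReal).map RatFunc.C)⁻¹ *
        (B.map Complex.ofReal).map RatFunc.C :=
  rfl

theorem mcmillanDegree_transferFunction_le (A : Matrix (Fin n) (Fin n) ℝ)
    (B : Matrix (Fin n) (Fin m) ℝ) : mcmillanDegree (transferFunction A B) ≤ n := by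
  rw [transferFunction_eq]
  refine (mcmillanDegree_mul_le _ _).trans ?_
  rw [mcmillanDegree_map_C, add_zero]
  exact (mcmillanDegree_inv_le _).trans (mcmillanDegree_X_sub_map_C_le _)

theorem minorsLE_map_algebraMap (a : ℂ) {P Q : Type*} (M : Matrix P Q ℂ[X]) :
    MinorsLE (placeValuation (some a)) 1 (M.map (algebraMap ℂ[X] (RatFunc ℂ))) :=
  .of_entries_le_one fun _ _ => (linearPrime a).valuation_le_one _

theorem rootMultiplicity_charpoly_le_poleDegree {A : Matrix (Fin n) (Fin n) ℂ}
    {B : Matrix (Fin n) (Fin m) ℂ} {U : Matrix (Fin n) (Fin n) ℂ[X]}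
    {V : Matrix (Fin m) (Fin n) ℂ[X]} (hUV : A.charmatrix * U + B.map C * V = 1) (a : ℂ) :
    A.charpoly.rootMultiplicity a ≤ poleDegree (some a)
      ((Matrix.scalar (Fin n) RatFunc.X - A.map RatFunc.C)⁻¹ * B.map RatFunc.C) := by
  let φ := algebraMap ℂ[X] (RatFunc ℂ)
  rw [← map_charmatrix]
  set Z : Matrix (Fin n) (Fin n) (RatFunc ℂ) := A.charmatrix.map φ
  have det_Z : Z.det = φ A.charpoly := (φ.map_det _).symm
  have charpoly_ne_zero := A.charpoly_monic.ne_zero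
  have isUnit_Z : IsUnit Z.det := by
    rw [det_Z, isUnit_iff_ne_zero]
    exact RatFunc.algebraMap_ne_zero charpoly_ne_zero
  have bezout : Z * U.map φ + B.map RatFunc.C * V.map φ = 1 := by
    have := congrArg (Matrix.map · φ) hUV
    simpa [Matrix.map_add, Matrix.map_mul, Function.comp_def, φ, RatFunc.algebraMap_C] using this
  have inv_Z : Z⁻¹ = U.map φ + Z⁻¹ * B.map RatFunc.C * V.map φ := by
    rw [Matrix.mul_assoc, ← Matrix.nonsing_inv_mul_cancel_left Z (U.map φ) isUnit_Z, ← mul_add,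
      bezout, mul_one]
  have minors := (minorsLE_map_algebraMap a U).add
    ((minorsLE_exp_poleDegree (some a) (Z⁻¹ * B.map RatFunc.C)).mul (minorsLE_map_algebraMap a V))
  rw [← inv_Z, one_mul, mul_one] at minors
  have det_le := minors n id id
  rw [Matrix.submatrix_id_id, Matrix.det_nonsing_inv, Ring.inverse_eq_inv', map_inv₀, det_Z,
    placeValuation_algebraMap charpoly_ne_zero, WithZero.exp_neg, inv_inv,
    WithZero.exp_le_exp] at det_le
  exact_mod_cast det_le

theorem mcmillanDegree_transferFunction
    (h : Submodule.span ℝ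
      (Set.range fun s : Fin n × Fin m => fun i => (A ^ (s.1 : ℕ) * B) i s.2) = ⊤) :
    mcmillanDegree (transferFunction A B) = n := by
  refine le_antisymm (mcmillanDegree_transferFunction_le A B) ?_
  obtain ⟨K, hK⟩ := exists_sum_pow_mul_mul_eq_one h
  have complex_hK := congrArg Complex.ofRealHom.mapMatrix hK
  simp only [map_sum, map_one, RingHom.mapMatrix_apply, Matrix.map_mul, Matrix.map_pow]
    at complex_hK
  obtain ⟨U, V, hUV⟩ := exists_charmatrix_mul_add_mul_eq_one complex_hK
  calc n = (A.map Complex.ofReal).charpoly.natDegree := by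
        rw [Matrix.charpoly_natDegree_eq_dim, Fintype.card_fin]
    _ = ∑ᶠ a, (A.map Complex.ofReal).charpoly.rootMultiplicity a :=
      (finsum_rootMultiplicity _).symm
    _ ≤ ∑ᶠ a, poleMultiplicity (transferFunction A B) a :=
      finsum_le_finsum' (hasFiniteSupport_rootMultiplicity _) (poleMultiplicity_support_finite _)
        (rootMultiplicity_charpoly_le_poleDegree hUV)
    _ ≤ mcmillanDegree (transferFunction A B) := Nat.le_add_right _ _

end TransferFunction

/-! ## Positive matrices -/

section PositiveMatrices

open scoped Matrix.Norms.L2Operator MatrixOrder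

variable {ι : Type*} [DecidableEq ι] {M N : Matrix ι ι ℂ}

theorem posDef_of_sub_smul_one_posDef {α : ℝ} (hα : 0 ≤ α)
    (h : (M - (α : ℂ) • (1 : Matrix ι ι ℂ)).PosDef) : M.PosDef := by
  have := h.add_posSemidef (Matrix.PosSemidef.one.smul (Complex.zero_le_real.2 hα))
  rwa [sub_add_cancel] at this

variable [Fintype ι]

theorem real_smul_one_eq_algebraMap (c : ℝ) :
    (c : ℂ) • (1 : Matrix ι ι ℂ) = algebraMap ℝ (Matrix ι ι ℂ) c := by
  rw [Algebra.algebraMap_eq_smul_one, Complex.coe_smul]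

theorem posSemidef_smul_one_sub (hM : M.IsHermitian) {c : ℝ} (hc : ‖M‖ ≤ c) :
    ((c : ℂ) • (1 : Matrix ι ι ℂ) - M).PosSemidef := by
  rw [real_smul_one_eq_algebraMap, ← Matrix.le_iff]
  calc M ≤ algebraMap ℝ _ ‖M‖ := IsSelfAdjoint.le_algebraMap_norm_self hM
    _ ≤ algebraMap ℝ _ c := algebraMap_mono _ hc

theorem norm_le_of_posSemidef_sub (hM : M.PosSemidef) (h : (N - M).PosSemidef) : ‖M‖ ≤ ‖N‖ :=
  CStarAlgebra.norm_le_norm_of_nonneg_of_le hM.nonneg h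

theorem norm_inv_le_of_sub_smul_one_posDef {α : ℝ} (hα : 0 < α)
    (h : (M - (α : ℂ) • (1 : Matrix ι ι ℂ)).PosDef) :
    ‖M⁻¹‖ ≤ ‖((α : ℂ) • (1 : Matrix ι ι ℂ))⁻¹‖ := by
  have posDef_smul_one : ((α : ℂ) • (1 : Matrix ι ι ℂ)).PosDef :=
    Matrix.PosDef.one.smul (Complex.zero_lt_real.2 hα)
  refine CStarAlgebra.norm_le_norm_of_nonneg_of_le
    (posDef_of_sub_smul_one_posDef hα.le h).inv.posSemidef.nonneg ?_
  rw [Matrix.nonsing_inv_eq_ringInverse, Matrix.nonsing_inv_eq_ringInverse]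
  exact CStarAlgebra.ringInverse_le_ringInverse (Matrix.le_iff.2 h.posSemidef)
    posDef_smul_one.isStrictlyPositive

theorem log_det_le_trace_sub_card (hM : M.PosDef) :
    Real.log M.det.re ≤ M.trace.re - Fintype.card ι := by
  have det_eq : M.det.re = ∏ i, hM.1.eigenvalues i := by
    rw [hM.1.det_eq_prod_eigenvalues]
    norm_cast
  have trace_eq : M.trace.re = ∑ i, hM.1.eigenvalues i := by
    rw [hM.1.trace_eq_sum_eigenvalues]
    norm_cast
  rw [det_eq, trace_eq, Real.log_prod fun i _ => (hM.eigenvalues_pos i).ne']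
  calc ∑ i, Real.log (hM.1.eigenvalues i) ≤ ∑ i, (hM.1.eigenvalues i - 1) :=
        Finset.sum_le_sum fun i _ => Real.log_le_sub_one_of_pos (hM.eigenvalues_pos i)
    _ = ∑ i, hM.1.eigenvalues i - Fintype.card ι := by
        rw [Finset.sum_sub_distrib, Finset.sum_const, Finset.card_univ, nsmul_one]

theorem log_det_inv_mul (hM : M.PosDef) (hN : N.PosDef) :
    Real.log (M⁻¹ * N).det.re = Real.log N.det.re - Real.log M.det.re := by
  obtain ⟨M_re_pos, M_im⟩ := Complex.pos_iff.1 hM.det_pos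
  obtain ⟨N_re_pos, -⟩ := Complex.pos_iff.1 hN.det_pos
  have det_eq : M.det * (M⁻¹ * N).det = N.det := by
    rw [← Matrix.det_mul, Matrix.mul_nonsing_inv_cancel_left _ _ hM.det_pos.ne'.isUnit]
  have re_eq : M.det.re * (M⁻¹ * N).det.re = N.det.re := by
    rw [← det_eq, Complex.mul_re, ← M_im, zero_mul, sub_zero]
  rw [eq_div_of_mul_eq M_re_pos.ne' ((mul_comm _ _).trans re_eq),
    Real.log_div N_re_pos.ne' M_re_pos.ne']

/-- Concavity of `log ∘ det`: the right-hand side is its tangent at `M`. -/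
theorem log_det_le (hM : M.PosDef) (hN : N.PosDef) :
    Real.log N.det.re ≤ Real.log M.det.re + (M⁻¹ * (N - M)).trace.re := by
  obtain ⟨B, hB, hMB⟩ := CStarAlgebra.isStrictlyPositive_iff_eq_star_mul_self.mp
    hM.inv.isStrictlyPositive
  have log_le := log_det_le_trace_sub_card ((Matrix.IsUnit.posDef_star_right_conjugate_iff hB).2 hN)
  have det_eq : (B * N * star B).det = (M⁻¹ * N).det := by
    rw [hMB, Matrix.det_mul, Matrix.det_mul, Matrix.det_mul, Matrix.det_mul]
    ring
  have trace_eq : (B * N * star B).trace = (M⁻¹ * N).trace := by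
    rw [hMB, Matrix.trace_mul_comm, Matrix.mul_assoc]
  rw [det_eq, trace_eq, log_det_inv_mul hM hN] at log_le
  rw [Matrix.mul_sub, Matrix.nonsing_inv_mul _ (Matrix.isUnit_iff_isUnit_det _ |>.1 hM.isUnit),
    Matrix.trace_sub, Matrix.trace_one, Complex.sub_re, Complex.natCast_re]
  linarith

theorem map_conj_inv (M : Matrix ι ι ℂ) :
    M⁻¹.map (starRingEnd ℂ) = (M.map (starRingEnd ℂ))⁻¹ := by
  have map_conj (N : Matrix ι ι ℂ) : N.map (starRingEnd ℂ) = Nᴴᵀ := rfl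
  rw [map_conj, map_conj, Matrix.conjTranspose_nonsing_inv, Matrix.transpose_nonsing_inv]

end PositiveMatrices

/-! ## Positive semidefinite bilinear forms -/

theorem exists_forall_apply_sub_map_eq_zero {W L : Type*} [AddCommGroup W] [Module ℝ W]
    [AddCommGroup L] [Module ℝ L] [FiniteDimensional ℝ L] {b : LinearMap.BilinForm ℝ W}
    (hb : b.IsPosSemidef) (J : L →ₗ[ℝ] W) (h : W) : ∃ v : L, ∀ u : L, b (h - J v) (J u) = 0 := by
  let gram : L →ₗ[ℝ] Module.Dual ℝ L := b.compl₁₂ J J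
  have mem_range : (b h).comp J ∈ LinearMap.range gram.dualMap := by
    rw [LinearMap.range_dualMap_eq_dualAnnihilator_ker, Submodule.mem_dualAnnihilator]
    intro u hu
    have isotropic : b (J u) (J u) = 0 := LinearMap.congr_fun (LinearMap.mem_ker.1 hu) u
    have ker : J u ∈ LinearMap.ker b :=
      (b.apply_apply_same_eq_zero_iff hb.nonneg (LinearMap.BilinForm.isSymm_iff.1 hb.isSymm)).1
        isotropic
    change b h (J u) = 0
    rw [hb.isSymm.eq, LinearMap.mem_ker.1 ker, LinearMap.zero_apply]
  obtain ⟨ξ, hξ⟩ := mem_range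
  obtain ⟨v, rfl⟩ := (Module.evalEquiv ℝ L).surjective ξ
  refine ⟨v, fun u => ?_⟩
  have : b (J u) (J v) = b h (J u) := LinearMap.congr_fun hξ u
  rw [map_sub, LinearMap.sub_apply, hb.isSymm.eq (J v), this, sub_self]

/-! ## Rational matrices on the unit circle -/

section OnCircle

open Filter Polynomial

/-- Lebesgue measure on the interval `(-π, π]` of angles. -/
abbrev angleMeasure : Measure ℝ :=
  volume.restrict (Set.Ioc (-Real.pi) Real.pi)

/-- The filter of the conull sets of the unit circle, so that `AECircle P` is
`∀ᶠ z in aeCircle, P z`. -/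
def aeCircle : Filter Circle :=
  map Circle.exp (ae angleMeasure)

theorem AECircle.eventually {P : Circle → Prop} (h : AECircle P) : ∀ᶠ z in aeCircle, P z := h

instance : NeBot aeCircle := by
  have : NeZero angleMeasure := by
    simp [neZero_iff, Real.pi_pos]
  exact map_neBot

theorem aeCircle_eval_ne_zero {p : ℂ[X]} (hp : p ≠ 0) :
    ∀ᶠ z : Circle in aeCircle, p.eval ↑z ≠ 0 := by
  have finite_roots : {θ | θ ∈ Set.Ioc (-Real.pi) Real.pi ∧ p.IsRoot (Circle.exp θ)}.Finite := by
    refine .of_finite_image (f := fun θ => (Circle.exp θ : ℂ))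
      ((finite_setOfPred_isRoot hp).subset ?_) ?_
    · rintro _ ⟨θ, hθ, rfl⟩
      exact hθ.2
    · exact fun θ hθ η hη h => Circle.exp_injOn_Ioc (by linarith) hθ.1 hη.1 (Circle.ext h)
  rw [aeCircle, eventually_map, ae_restrict_iff' measurableSet_Ioc]
  filter_upwards [compl_mem_ae_iff.2 (finite_roots.measure_zero volume)] with θ hθ hI hroot
  exact hθ ⟨hI, hroot⟩

theorem aeCircle_denom_ne_zero (f : RatFunc ℂ) :
    ∀ᶠ z : Circle in aeCircle, eval₂ (RingHom.id ℂ) ↑z f.denom ≠ 0 :=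
  aeCircle_eval_ne_zero f.denom_ne_zero

/-- Rational functions as germs of functions on the unit circle, modulo null sets. The evaluation
at a single point is not a ring homomorphism, because of the poles there. -/
def circleGerm : RatFunc ℂ →+* Germ aeCircle ℂ where
  toFun f := ↑fun z : Circle => f.eval (RingHom.id ℂ) ↑z
  map_zero' := by simp only [RatFunc.eval_zero]; rfl
  map_one' := by simp only [RatFunc.eval_one]; rfl
  map_add' f g := Germ.coe_eq.2 <| by
    filter_upwards [aeCircle_denom_ne_zero f, aeCircle_denom_ne_zero g] with z hf hg
    exact RatFunc.eval_add _ _ hf hg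
  map_mul' f g := Germ.coe_eq.2 <| by
    filter_upwards [aeCircle_denom_ne_zero f, aeCircle_denom_ne_zero g] with z hf hg
    exact RatFunc.eval_mul _ _ hf hg

variable {p q r : ℕ}

theorem onCircle_eventuallyEq {M : Matrix (Fin p) (Fin q) (RatFunc ℂ)}
    {f : Circle → Matrix (Fin p) (Fin q) ℂ}
    (h : ∀ i j, circleGerm (M i j) = ↑fun z => f z i j) :
    ∀ᶠ z in aeCircle, onCircle M z = f z := by
  filter_upwards [eventually_all.2 fun i => eventually_all.2 fun j => Germ.coe_eq.1 (h i j)]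
    with z hz
  exact Matrix.ext hz

theorem onCircle_add (M N : Matrix (Fin p) (Fin q) (RatFunc ℂ)) :
    ∀ᶠ z in aeCircle, onCircle (M + N) z = onCircle M z + onCircle N z :=
  onCircle_eventuallyEq fun _ _ => map_add circleGerm _ _

theorem onCircle_sub (M N : Matrix (Fin p) (Fin q) (RatFunc ℂ)) :
    ∀ᶠ z in aeCircle, onCircle (M - N) z = onCircle M z - onCircle N z :=
  onCircle_eventuallyEq fun _ _ => map_sub circleGerm _ _

/-- The entries of `M` as functions on the unit circle. -/
def circleEntries (M : Matrix (Fin p) (Fin q) (RatFunc ℂ)) : Matrix (Fin p) (Fin q) (Circle → ℂ) :=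
  M.map fun f z => f.eval (RingHom.id ℂ) ↑z

theorem onCircle_mul (M : Matrix (Fin p) (Fin q) (RatFunc ℂ))
    (N : Matrix (Fin q) (Fin r) (RatFunc ℂ)) :
    ∀ᶠ z in aeCircle, onCircle (M * N) z = onCircle M z * onCircle N z := by
  refine onCircle_eventuallyEq fun i j => ?_
  calc circleGerm ((M * N) i j) = (M.map circleGerm * N.map circleGerm) i j :=
        circleGerm.map_matrix_mul M N i j
    _ = Germ.coeRingHom aeCircle ((circleEntries M * circleEntries N) i j) :=
        ((Germ.coeRingHom aeCircle).map_matrix_mul _ _ i j).symm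
    _ = ↑fun z => (onCircle M z * onCircle N z) i j := congrArg _ (funext fun z =>
        (Pi.evalRingHom (fun _ => ℂ) z).map_matrix_mul (circleEntries M) (circleEntries N) i j)

theorem aeCircle_eval_det (M : Matrix (Fin p) (Fin p) (RatFunc ℂ)) :
    ∀ᶠ z : Circle in aeCircle, M.det.eval (RingHom.id ℂ) ↑z = (onCircle M z).det := by
  refine Germ.coe_eq.1 ?_
  calc circleGerm M.det = (M.map circleGerm).det := circleGerm.map_det M
    _ = Germ.coeRingHom aeCircle (circleEntries M).det := by
        rw [RingHom.map_det]
        rfl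
    _ = ↑fun z => (onCircle M z).det :=
        congrArg _ (funext fun z => (Pi.evalRingHom (fun _ => ℂ) z).map_det (circleEntries M))

theorem onCircle_inv {M : Matrix (Fin p) (Fin p) (RatFunc ℂ)}
    (hM : ∀ᶠ z in aeCircle, IsUnit (onCircle M z)) :
    ∀ᶠ z in aeCircle, onCircle M⁻¹ z = (onCircle M z)⁻¹ := by
  have det_ne_zero : M.det ≠ 0 := by
    intro h
    obtain ⟨z, hz, hdet⟩ := (hM.and (aeCircle_eval_det M)).exists
    rw [h, RatFunc.eval_zero] at hdet
    exact ((Matrix.isUnit_iff_isUnit_det _).1 hz).ne_zero hdet.symm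
  have inv_mul := onCircle_mul M⁻¹ M
  rw [Matrix.nonsing_inv_mul _ det_ne_zero.isUnit] at inv_mul
  filter_upwards [inv_mul] with z hz
  refine (Matrix.inv_eq_left_inv (hz.symm.trans ?_)).symm
  rw [onCircle, Matrix.map_one _ (RatFunc.eval_zero _ _) (RatFunc.eval_one _ _)]

theorem onCircle_map_C (A : Matrix (Fin p) (Fin q) ℂ) (z : Circle) :
    onCircle (A.map RatFunc.C) z = A := by
  ext
  simp [onCircle]

theorem onCircle_scalar_sub_map_C_inv {f : RatFunc ℂ} {g : Circle → ℂ}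
    (hf : ∀ᶠ z : Circle in aeCircle, f.eval (RingHom.id ℂ) ↑z = g z)
    {A : Matrix (Fin p) (Fin p) ℂ} (hA : ∀ z, IsUnit (Matrix.scalar (Fin p) (g z) - A)) :
    ∀ᶠ z in aeCircle, onCircle (Matrix.scalar (Fin p) f - A.map RatFunc.C)⁻¹ z =
      (Matrix.scalar (Fin p) (g z) - A)⁻¹ := by
  have values : ∀ᶠ z in aeCircle, onCircle (Matrix.scalar (Fin p) f - A.map RatFunc.C) z =
      Matrix.scalar (Fin p) (g z) - A := by
    filter_upwards [onCircle_sub (Matrix.scalar (Fin p) f) (A.map RatFunc.C), hf] with z hz hfz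
    rw [hz, onCircle_map_C, ← hfz, onCircle, Matrix.scalar_apply,
      Matrix.diagonal_map (RatFunc.eval_zero _ _), Matrix.scalar_apply]
  have isUnit_values := values.mono fun z hz => hz.symm ▸ hA z
  filter_upwards [values, onCircle_inv isUnit_values] with z hz hinv
  rw [hinv, hz]

theorem aeCircle_eval_X_inv :
    ∀ᶠ z : Circle in aeCircle, (RatFunc.X⁻¹ : RatFunc ℂ).eval (RingHom.id ℂ) ↑z = star (z : ℂ) := by
  have : circleGerm RatFunc.X⁻¹ * circleGerm RatFunc.X = 1 := by
    rw [← map_mul, inv_mul_cancel₀ RatFunc.X_ne_zero, map_one]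
  filter_upwards [Germ.coe_eq.1 this] with z hz
  have inverse : RatFunc.eval (RingHom.id ℂ) (z : ℂ) RatFunc.X⁻¹ * z = 1 := by
    simpa only [RatFunc.eval_X] using hz
  rw [eq_inv_of_mul_eq_one_left inverse, ← Circle.coe_inv, Circle.coe_inv_eq_conj]
  rfl

/-! ## Rationality of the approximants -/

theorem isUnit_scalar_sub {A : Matrix (Fin p) (Fin p) ℂ}
    (hA : ∀ a : ℂ, A.charpoly.IsRoot a → ‖a‖ < 1) {a : ℂ} (ha : 1 ≤ ‖a‖) :
    IsUnit (Matrix.scalar (Fin p) a - A) := by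
  rw [Matrix.isUnit_iff_isUnit_det, isUnit_iff_ne_zero, ← Matrix.eval_charpoly]
  exact fun hroot => (hA a hroot).not_ge ha

theorem conjTranspose_scalar_sub (a : ℂ) (A : Matrix (Fin p) (Fin p) ℂ) :
    (Matrix.scalar (Fin p) a - A)ᴴ = Matrix.scalar (Fin p) (star a) - Aᴴ := by
  rw [Matrix.conjTranspose_sub, Matrix.scalar_apply, Matrix.diagonal_conjTranspose]
  rfl

variable {n m : ℕ} {A : Matrix (Fin n) (Fin n) ℝ}

theorem onCircle_transferFunction
    (hA : ∀ a : ℂ, (A.map Complex.ofReal).charpoly.IsRoot a → ‖a‖ < 1)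
    (B : Matrix (Fin n) (Fin m) ℝ) : ∀ᶠ z in aeCircle, onCircle (transferFunction A B) z =
      (Matrix.scalar (Fin n) (z : ℂ) - A.map Complex.ofReal)⁻¹ * B.map Complex.ofReal := by
  have resolvent := onCircle_scalar_sub_map_C_inv (f := RatFunc.X) (g := fun z => (z : ℂ))
    (.of_forall fun z => RatFunc.eval_X _ _) fun z => isUnit_scalar_sub hA z.norm_coe.ge
  filter_upwards [resolvent, onCircle_mul (Matrix.scalar (Fin n) RatFunc.X -
    (A.map Complex.ofReal).map RatFunc.C)⁻¹ ((B.map Complex.ofReal).map RatFunc.C)] with z hz hmul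
  rw [transferFunction_eq, hmul, hz, onCircle_map_C]

/-- The rational matrix `G*(z) = G(z⁻¹)ᵀ`, for `G = transferFunction A B`. -/
def conjTransferFunction (A : Matrix (Fin n) (Fin n) ℝ) (B : Matrix (Fin n) (Fin m) ℝ) :
    Matrix (Fin m) (Fin n) (RatFunc ℂ) :=
  ((B.map Complex.ofReal)ᴴ).map RatFunc.C *
    (Matrix.scalar (Fin n) RatFunc.X⁻¹ - ((A.map Complex.ofReal)ᴴ).map RatFunc.C)⁻¹

theorem mcmillanDegree_conjTransferFunction_le (A : Matrix (Fin n) (Fin n) ℝ)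
    (B : Matrix (Fin n) (Fin m) ℝ) : mcmillanDegree (conjTransferFunction A B) ≤ n := by
  refine (mcmillanDegree_mul_le _ _).trans ?_
  rw [mcmillanDegree_map_C, zero_add]
  exact (mcmillanDegree_inv_le _).trans (mcmillanDegree_X_inv_sub_map_C_le _)

theorem onCircle_conjTransferFunction
    (hA : ∀ a : ℂ, (A.map Complex.ofReal).charpoly.IsRoot a → ‖a‖ < 1)
    (B : Matrix (Fin n) (Fin m) ℝ) : ∀ᶠ z in aeCircle,
      onCircle (conjTransferFunction A B) z = (onCircle (transferFunction A B) z)ᴴ := by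
  have isUnit_conj (z : Circle) :
      IsUnit (Matrix.scalar (Fin n) (star (z : ℂ)) - (A.map Complex.ofReal)ᴴ) := by
    rw [← conjTranspose_scalar_sub, Matrix.isUnit_conjTranspose]
    exact isUnit_scalar_sub hA z.norm_coe.ge
  have resolvent := onCircle_scalar_sub_map_C_inv aeCircle_eval_X_inv isUnit_conj
  filter_upwards [resolvent, onCircle_transferFunction hA B, onCircle_mul
    (((B.map Complex.ofReal)ᴴ).map RatFunc.C) (Matrix.scalar (Fin n) RatFunc.X⁻¹ -
      ((A.map Complex.ofReal)ᴴ).map RatFunc.C)⁻¹] with z hz hG hmul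
  rw [conjTransferFunction, hmul, hz, hG, onCircle_map_C, Matrix.conjTranspose_mul,
    Matrix.conjTranspose_nonsing_inv, conjTranspose_scalar_sub]

theorem isRationalOfDegreeLE_approximant
    (hA : ∀ a : ℂ, (A.map Complex.ofReal).charpoly.IsRoot a → ‖a‖ < 1)
    (B : Matrix (Fin n) (Fin m) ℝ) {Ψ : Matrix (Fin m) (Fin m) (RatFunc ℂ)}
    (hΨ : ∀ᶠ z in aeCircle, IsUnit (onCircle Ψ z)) {Λ : Matrix (Fin n) (Fin n) ℝ}
    (hΛ : IsMultiplier (onCircle (transferFunction A B)) (onCircle Ψ) Λ) :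
    IsRationalOfDegreeLE (approximant (onCircle (transferFunction A B)) (onCircle Ψ) Λ)
      (mcmillanDegree Ψ + 2 * n) := by
  let correction := conjTransferFunction A B * (Λ.map Complex.ofReal).map RatFunc.C *
    transferFunction A B
  have values : ∀ᶠ z in aeCircle, onCircle (Ψ⁻¹ + correction) z =
      inverseApproximant (onCircle (transferFunction A B)) (onCircle Ψ) Λ z := by
    filter_upwards [onCircle_add Ψ⁻¹ correction, onCircle_inv hΨ,
      onCircle_mul (conjTransferFunction A B * (Λ.map Complex.ofReal).map RatFunc.C)
        (transferFunction A B),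
      onCircle_mul (conjTransferFunction A B) ((Λ.map Complex.ofReal).map RatFunc.C),
      onCircle_conjTransferFunction hA B] with z hadd hinv hmul hmul' hconj
    rw [hadd, hinv, hmul, hmul', hconj, onCircle_map_C, inverseApproximant]
  have isUnit_values : ∀ᶠ z in aeCircle, IsUnit (onCircle (Ψ⁻¹ + correction) z) := by
    filter_upwards [values, hΛ.2.eventually] with z hz hpos
    exact hz ▸ hpos.isUnit
  refine ⟨(Ψ⁻¹ + correction)⁻¹, ?_, ?_⟩
  · filter_upwards [values, onCircle_inv isUnit_values] with z hz hinv
    rw [hinv, hz, approximant]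
  · calc mcmillanDegree (Ψ⁻¹ + correction)⁻¹ ≤ mcmillanDegree (Ψ⁻¹ + correction) :=
          mcmillanDegree_inv_le _
      _ ≤ mcmillanDegree Ψ⁻¹ + mcmillanDegree correction := mcmillanDegree_add_le _ _
      _ ≤ mcmillanDegree Ψ + (n + 0 + n) := by
        refine add_le_add (mcmillanDegree_inv_le Ψ) ((mcmillanDegree_mul_le _ _).trans
          (add_le_add ((mcmillanDegree_mul_le _ _).trans ?_) ?_))
        · rw [mcmillanDegree_map_C]
          exact add_le_add (mcmillanDegree_conjTransferFunction_le A B) le_rfl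
        · exact mcmillanDegree_transferFunction_le A B
      _ = mcmillanDegree Ψ + 2 * n := by ring

end OnCircle

/-! ## Essentially bounded matrix functions on the unit circle -/

section EssBounded

open Filter
open scoped Matrix.Norms.L2Operator

/-- Measurable and essentially bounded matrix functions on the unit circle. -/
def IsEssBounded {ι κ : Type*} [Fintype ι] [Fintype κ] [DecidableEq κ]
    (F : Circle → Matrix ι κ ℂ) : Prop :=
  MemLp (fun θ => F (Circle.exp θ)) ⊤ angleMeasure

variable {ι κ μ : Type*} [Fintype ι] [Fintype κ] [DecidableEq κ] {F : Circle → Matrix ι κ ℂ}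

theorem isEssBounded_of_norm_le
    (hF : ∀ i j, AEMeasurable (fun θ => F (Circle.exp θ) i j) angleMeasure) {C : ℝ}
    (hC : ∀ᶠ z in aeCircle, ‖F z‖ ≤ C) : IsEssBounded F := by
  have measurable : AEMeasurable (fun θ i j => F (Circle.exp θ) i j) angleMeasure :=
    aemeasurable_pi_lambda _ fun i => aemeasurable_pi_lambda _ (hF i)
  exact memLp_top_of_bound measurable.aestronglyMeasurable C hC

theorem isEssBounded_of_continuous (hF : Continuous F) : IsEssBounded F := by
  obtain ⟨C, hC⟩ := isCompact_univ.exists_bound_of_continuousOn hF.continuousOn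
  exact memLp_top_of_bound (hF.comp Circle.exp.continuous).aestronglyMeasurable C
    (.of_forall fun θ => hC _ (Set.mem_univ _))

theorem isEssBounded_const (M : Matrix ι κ ℂ) : IsEssBounded fun _ => M :=
  memLp_top_const M

namespace IsEssBounded

theorem congr {F' : Circle → Matrix ι κ ℂ} (hF : IsEssBounded F)
    (h : ∀ᶠ z in aeCircle, F z = F' z) : IsEssBounded F' :=
  MemLp.ae_eq h hF

theorem add {K : Circle → Matrix ι κ ℂ} (hF : IsEssBounded F) (hK : IsEssBounded K) :
    IsEssBounded fun z => F z + K z :=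
  MemLp.add hF hK

theorem sub {K : Circle → Matrix ι κ ℂ} (hF : IsEssBounded F) (hK : IsEssBounded K) :
    IsEssBounded fun z => F z - K z :=
  MemLp.sub hF hK

theorem smul (c : ℂ) (hF : IsEssBounded F) : IsEssBounded fun z => c • F z :=
  MemLp.const_smul hF c

theorem exists_norm_le (hF : IsEssBounded F) : ∃ C : ℝ, 0 ≤ C ∧ ∀ᶠ z in aeCircle, ‖F z‖ ≤ C := by
  have ne_top : eLpNormEssSup (fun θ => F (Circle.exp θ)) angleMeasure ≠ ⊤ :=
    eLpNorm_exponent_top (f := fun θ => F (Circle.exp θ)) ▸ hF.eLpNorm_ne_top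
  have bound : ∀ᵐ θ ∂angleMeasure, ‖F (Circle.exp θ)‖ ≤
      (eLpNormEssSup (fun θ => F (Circle.exp θ)) angleMeasure).toReal := by
    filter_upwards [ae_le_eLpNormEssSup (f := fun θ => F (Circle.exp θ))] with θ hθ
    simpa only [toReal_enorm] using ENNReal.toReal_mono ne_top hθ
  exact ⟨_, ENNReal.toReal_nonneg, bound⟩

theorem integrable_apply (hF : IsEssBounded F) (i : ι) (j : κ) :
    Integrable (fun θ => F (Circle.exp θ) i j) angleMeasure :=
  (LinearMap.toContinuousLinearMap (Matrix.entryLinearMap ℂ ℂ i j)).integrable_comp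
    (MemLp.integrable le_top hF)

theorem integrable_re_trace {F : Circle → Matrix κ κ ℂ} (hF : IsEssBounded F) :
    Integrable (fun θ => (F (Circle.exp θ)).trace.re) angleMeasure :=
  (integrable_finsetSum _ fun i _ => hF.integrable_apply i i).re

theorem mul [Fintype μ] [DecidableEq μ] {K : Circle → Matrix κ μ ℂ} (hF : IsEssBounded F)
    (hK : IsEssBounded K) : IsEssBounded fun z => F z * K z := by
  obtain ⟨a, ha, hFa⟩ := hF.exists_norm_le
  obtain ⟨b, -, hKb⟩ := hK.exists_norm_le
  have measurable (i : ι) (j : μ) :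
      AEMeasurable (fun θ => (F (Circle.exp θ) * K (Circle.exp θ)) i j) angleMeasure := by
    simp only [Matrix.mul_apply]
    exact Finset.aemeasurable_fun_sum _ fun k _ =>
      (hF.integrable_apply i k).aemeasurable.mul (hK.integrable_apply k j).aemeasurable
  have bound : ∀ᶠ z in aeCircle, ‖F z * K z‖ ≤ a * b := by
    filter_upwards [hFa, hKb] with z hza hzb
    exact (Matrix.l2_opNorm_mul _ _).trans (mul_le_mul hza hzb (norm_nonneg _) ha)
  exact isEssBounded_of_norm_le measurable bound

theorem conjTranspose [DecidableEq ι] (hF : IsEssBounded F) : IsEssBounded fun z => (F z)ᴴ :=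
  MemLp.of_le hF (continuous_id.matrix_conjTranspose.comp_aestronglyMeasurable hF.1)
    (.of_forall fun _ => (Matrix.l2_opNorm_conjTranspose _).le)

theorem inv {F : Circle → Matrix κ κ ℂ} (hF : IsEssBounded F) {α : ℝ} (hα : 0 < α)
    (h : ∀ᶠ z in aeCircle, (F z - (α : ℂ) • (1 : Matrix κ κ ℂ)).PosDef) :
    IsEssBounded fun z => (F z)⁻¹ := by
  have det_measurable : AEMeasurable (fun θ => (F (Circle.exp θ)).det) angleMeasure :=
    (continuous_id.matrix_det.comp_aestronglyMeasurable hF.1).aemeasurable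
  have adjugate_measurable (i j : κ) :
      AEMeasurable (fun θ => (F (Circle.exp θ)).adjugate i j) angleMeasure :=
    ((continuous_id.matrix_adjugate.matrix_elem i j).comp_aestronglyMeasurable hF.1).aemeasurable
  have measurable (i j : κ) : AEMeasurable (fun θ => (F (Circle.exp θ))⁻¹ i j) angleMeasure := by
    simp only [Matrix.inv_def, Ring.inverse_eq_inv', Matrix.smul_apply, smul_eq_mul]
    exact det_measurable.inv.mul (adjugate_measurable i j)
  have bound : ∀ᶠ z in aeCircle, ‖(F z)⁻¹‖ ≤ ‖((α : ℂ) • (1 : Matrix κ κ ℂ))⁻¹‖ := by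
    filter_upwards [h] with z hz
    exact norm_inv_le_of_sub_smul_one_posDef hα hz
  exact isEssBounded_of_norm_le measurable bound

end IsEssBounded

theorem tendsto_integral_re_trace {β : Type*} {l : Filter β} [l.IsCountablyGenerated]
    {F : β → Circle → Matrix κ κ ℂ} {K : Circle → Matrix κ κ ℂ} {C : ℝ}
    (hF : ∀ᶠ t in l, IsEssBounded (F t)) (hC : ∀ᶠ t in l, ∀ᶠ z in aeCircle, ‖F t z‖ ≤ C)
    (h : ∀ᶠ z in aeCircle, Tendsto (fun t => F t z) l (nhds (K z))) :
    Tendsto (fun t => ∫ θ, (F t (Circle.exp θ)).trace.re ∂angleMeasure) l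
      (nhds (∫ θ, (K (Circle.exp θ)).trace.re ∂angleMeasure)) := by
  let trace : Matrix κ κ ℂ →L[ℂ] ℂ := (Matrix.traceLinearMap κ ℂ ℂ).toContinuousLinearMap
  have bound : ∀ᶠ t in l, ∀ᶠ z in aeCircle, ‖(F t z).trace.re‖ ≤ ‖trace‖ * C := by
    filter_upwards [hC] with t ht
    filter_upwards [ht] with z hz
    exact (Complex.abs_re_le_norm _).trans (trace.le_opNorm_of_le hz)
  have pointwise : ∀ᶠ z in aeCircle,
      Tendsto (fun t => (F t z).trace.re) l (nhds (K z).trace.re) := by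
    filter_upwards [h] with z hz
    exact ((Complex.continuous_re.comp trace.continuous).tendsto (K z)).comp hz
  exact tendsto_integral_filter_of_dominated_convergence (fun _ => ‖trace‖ * C)
    (hF.mono fun t ht => ht.integrable_re_trace.1) bound (integrable_const _) pointwise

end EssBounded

/-! ## Relative entropy rate -/

section RelativeEntropyRate

open Filter
open scoped Matrix.Norms.L2Operator

theorem intervalIntegral_neg_pi_pi {E : Type*} [NormedAddCommGroup E] [NormedSpace ℝ E]
    (f : ℝ → E) : ∫ θ in (-Real.pi)..Real.pi, f θ = ∫ θ, f θ ∂angleMeasure :=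
  intervalIntegral.integral_of_le (by linarith [Real.pi_pos])

theorem integral_congr_aeCircle {f g : Circle → ℝ} (h : ∀ᶠ z in aeCircle, f z = g z) :
    ∫ θ, f (Circle.exp θ) ∂angleMeasure = ∫ θ, g (Circle.exp θ) ∂angleMeasure :=
  integral_congr_ae h

variable {m : ℕ} {Φ Φ' Ψ : Circle → Matrix (Fin m) (Fin m) ℂ}

namespace IsSpectralDensity

theorem posDef (hΦ : IsSpectralDensity Φ) : ∀ᶠ z in aeCircle, (Φ z).PosDef := by
  obtain ⟨α, hα, hcoercive⟩ := hΦ.coercive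
  exact hcoercive.mono fun z => posDef_of_sub_smul_one_posDef hα.le

theorem isEssBounded (hΦ : IsSpectralDensity Φ) : IsEssBounded Φ := by
  obtain ⟨c, hc⟩ := hΦ.bounded
  refine isEssBounded_of_norm_le hΦ.measurable (C := ‖(c : ℂ) • (1 : Matrix (Fin m) (Fin m) ℂ)‖) ?_
  filter_upwards [hΦ.posDef, hc.eventually] with z hpos hz
  exact norm_le_of_posSemidef_sub hpos.posSemidef hz

theorem isEssBounded_inv (hΦ : IsSpectralDensity Φ) : IsEssBounded fun z => (Φ z)⁻¹ := by
  obtain ⟨α, hα, hcoercive⟩ := hΦ.coercive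
  exact hΦ.isEssBounded.inv hα hcoercive

theorem integrable_log_det (hΦ : IsSpectralDensity Φ) :
    Integrable (fun θ => Real.log (Φ (Circle.exp θ)).det.re) angleMeasure := by
  have det_measurable : AEMeasurable (fun θ => (Φ (Circle.exp θ)).det) angleMeasure :=
    (continuous_id.matrix_det.comp_aestronglyMeasurable hΦ.isEssBounded.1).aemeasurable
  have measurable : AEMeasurable (fun θ => Real.log (Φ (Circle.exp θ)).det.re) angleMeasure :=
    Real.measurable_log.comp_aemeasurable (Complex.measurable_re.comp_aemeasurable det_measurable)
  have lower : ∀ᶠ z in aeCircle, -((Φ z)⁻¹ * (1 - Φ z)).trace.re ≤ Real.log (Φ z).det.re := by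
    filter_upwards [hΦ.posDef] with z hz
    have := log_det_le hz Matrix.PosDef.one
    rw [Matrix.det_one, Complex.one_re, Real.log_one] at this
    linarith
  have upper : ∀ᶠ z in aeCircle, Real.log (Φ z).det.re ≤ (Φ z - 1).trace.re := by
    filter_upwards [hΦ.posDef] with z hz
    simpa only [Matrix.det_one, Complex.one_re, Real.log_one, zero_add, inv_one, one_mul]
      using log_det_le Matrix.PosDef.one hz
  have isEssBounded_one := isEssBounded_const (1 : Matrix (Fin m) (Fin m) ℂ)
  have lower_integrable :=
    (hΦ.isEssBounded_inv.mul (isEssBounded_one.sub hΦ.isEssBounded)).integrable_re_trace.neg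
  have upper_integrable := (hΦ.isEssBounded.sub isEssBounded_one).integrable_re_trace
  exact integrable_of_le_of_le measurable.aestronglyMeasurable lower upper lower_integrable
    upper_integrable

end IsSpectralDensity

theorem rerDist_eq_integral (hΦ : IsSpectralDensity Φ) (hΨ : IsSpectralDensity Ψ) :
    rerDist Φ Ψ = (4 * Real.pi)⁻¹ * ∫ θ, (Real.log (Ψ (Circle.exp θ)).det.re -
      Real.log (Φ (Circle.exp θ)).det.re + ((Ψ (Circle.exp θ))⁻¹ *
        (Φ (Circle.exp θ) - Ψ (Circle.exp θ))).trace.re) ∂angleMeasure := by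
  have integrand_eq : ∀ᶠ z in aeCircle,
      Real.log ((Φ z)⁻¹ * Ψ z).det.re + ((Ψ z)⁻¹ * (Φ z - Ψ z)).trace.re =
        Real.log (Ψ z).det.re - Real.log (Φ z).det.re + ((Ψ z)⁻¹ * (Φ z - Ψ z)).trace.re := by
    filter_upwards [hΦ.posDef, hΨ.posDef] with z hz hz'
    rw [log_det_inv_mul hz hz']
  rw [rerDist, intervalIntegral_neg_pi_pi, integral_congr_aeCircle integrand_eq]

/-- Bounding `rerDist Φ' Ψ - rerDist Φ Ψ` by the tangent at `Φ'` rather than at `Φ` turns it into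
an upper bound, by concavity of `log ∘ det`. -/
theorem rerDist_sub_le (hΦ : IsSpectralDensity Φ) (hΦ' : IsSpectralDensity Φ')
    (hΨ : IsSpectralDensity Ψ) :
    rerDist Φ' Ψ - rerDist Φ Ψ ≤ (4 * Real.pi)⁻¹ * ∫ θ, (((Φ' (Circle.exp θ))⁻¹ -
      (Ψ (Circle.exp θ))⁻¹) * (Φ (Circle.exp θ) - Φ' (Circle.exp θ))).trace.re ∂angleMeasure := by
  have integrable {Φ : Circle → Matrix (Fin m) (Fin m) ℂ} (hΦ : IsSpectralDensity Φ) :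
      Integrable (fun θ => Real.log (Ψ (Circle.exp θ)).det.re -
        Real.log (Φ (Circle.exp θ)).det.re + ((Ψ (Circle.exp θ))⁻¹ *
          (Φ (Circle.exp θ) - Ψ (Circle.exp θ))).trace.re) angleMeasure :=
    (hΨ.integrable_log_det.sub hΦ.integrable_log_det).add
      (hΨ.isEssBounded_inv.mul (hΦ.isEssBounded.sub hΨ.isEssBounded)).integrable_re_trace
  have integrable_tangent :=
    ((hΦ'.isEssBounded_inv.sub hΨ.isEssBounded_inv).mul
      (hΦ.isEssBounded.sub hΦ'.isEssBounded)).integrable_re_trace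
  have integrand_le : ∀ᶠ z in aeCircle,
      Real.log (Ψ z).det.re - Real.log (Φ' z).det.re + ((Ψ z)⁻¹ * (Φ' z - Ψ z)).trace.re -
        (Real.log (Ψ z).det.re - Real.log (Φ z).det.re + ((Ψ z)⁻¹ * (Φ z - Ψ z)).trace.re) ≤
      (((Φ' z)⁻¹ - (Ψ z)⁻¹) * (Φ z - Φ' z)).trace.re := by
    filter_upwards [hΦ.posDef, hΦ'.posDef] with z hz hz'
    have tangent := log_det_le hz' hz
    simp only [sub_mul, mul_sub, Matrix.trace_sub, Complex.sub_re] at tangent ⊢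
    linarith
  rw [rerDist_eq_integral hΦ hΨ, rerDist_eq_integral hΦ' hΨ, ← mul_sub,
    ← integral_sub (integrable hΦ') (integrable hΦ)]
  exact mul_le_mul_of_nonneg_left (integral_mono_ae ((integrable hΦ').sub (integrable hΦ))
    integrable_tangent integrand_le) (by positivity)

end RelativeEntropyRate

/-! ## Perturbations of spectral densities -/

section Perturbations

open Filter
open scoped Matrix.Norms.L2Operator

variable {m : ℕ}

/-- The real vector space of perturbations of spectral densities: the essentially bounded Hermitian
matrix functions with the symmetry of real processes. -/
def perturbationSpace (m : ℕ) : Submodule ℝ (Circle → Matrix (Fin m) (Fin m) ℂ) where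
  carrier := {F | IsEssBounded F ∧ (∀ᶠ z in aeCircle, (F z).IsHermitian) ∧
    ∀ᶠ z in aeCircle, F z⁻¹ = (F z).map (starRingEnd ℂ)}
  add_mem' {F K} hF hK := by
    refine ⟨hF.1.add hK.1, (hF.2.1.and hK.2.1).mono fun z h => h.1.add h.2, ?_⟩
    filter_upwards [hF.2.2, hK.2.2] with z hFz hKz
    rw [Pi.add_apply, hFz, hKz, Pi.add_apply, Matrix.map_add _ (map_add _)]
  zero_mem' := ⟨isEssBounded_const 0, .of_forall fun _ => Matrix.isHermitian_zero,
    .of_forall fun _ => (Matrix.map_zero _ (map_zero _)).symm⟩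
  smul_mem' c F hF := by
    refine ⟨hF.1.smul c, hF.2.1.mono fun z h => h.smul (.all c), hF.2.2.mono fun z h => ?_⟩
    rw [Pi.smul_apply, h, Pi.smul_apply]
    ext i j
    simp only [Matrix.smul_apply, Matrix.map_apply, Complex.real_smul, map_mul, Complex.conj_ofReal]

namespace IsSpectralDensity

variable {Φ : Circle → Matrix (Fin m) (Fin m) ℂ}

theorem mem_perturbationSpace (hΦ : IsSpectralDensity Φ) : Φ ∈ perturbationSpace m :=
  ⟨hΦ.isEssBounded, hΦ.posDef.mono fun _ h => h.isHermitian, hΦ.real⟩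

theorem inv_mem_perturbationSpace (hΦ : IsSpectralDensity Φ) :
    (fun z => (Φ z)⁻¹) ∈ perturbationSpace m := by
  refine ⟨hΦ.isEssBounded_inv, hΦ.posDef.mono fun _ h => h.isHermitian.inv, ?_⟩
  filter_upwards [hΦ.real.eventually] with z hz
  rw [hz, map_conj_inv]

end IsSpectralDensity

theorem isSpectralDensity_of_mem_perturbationSpace {F : Circle → Matrix (Fin m) (Fin m) ℂ}
    (hF : F ∈ perturbationSpace m) {α : ℝ} (hα : 0 < α)
    (h : ∀ᶠ z in aeCircle, (F z - (α : ℂ) • (1 : Matrix (Fin m) (Fin m) ℂ)).PosDef) :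
    IsSpectralDensity F where
  measurable i j := (hF.1.integrable_apply i j).aemeasurable
  real := hF.2.2
  bounded := by
    obtain ⟨c, -, hc⟩ := hF.1.exists_norm_le
    exact ⟨c, (hF.2.1.and hc).mono fun z hz => posSemidef_smul_one_sub hz.1 hz.2⟩
  coercive := ⟨α, hα, h⟩

theorem IsSpectralDensity.exists_eventually_posDef_add_smul
    {Φ : Circle → Matrix (Fin m) (Fin m) ℂ} (hΦ : IsSpectralDensity Φ) (D : perturbationSpace m) :
    ∃ α : ℝ, 0 < α ∧ ∀ᶠ t : ℝ in nhdsWithin 0 (Set.Ioi 0), ∀ᶠ z in aeCircle,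
      ((Φ + t • D.1) z - (α : ℂ) • (1 : Matrix (Fin m) (Fin m) ℂ)).PosDef := by
  obtain ⟨α, hα, hcoercive⟩ := hΦ.coercive
  obtain ⟨K, -, hD⟩ := D.2.1.exists_norm_le
  have small : ∀ᶠ t : ℝ in nhdsWithin 0 (Set.Ioi 0), t * K < α / 2 := by
    have : Tendsto (fun t : ℝ => t * K) (nhdsWithin 0 (Set.Ioi 0)) (nhds (0 * K)) :=
      (tendsto_nhdsWithin_of_tendsto_nhds tendsto_id).mul_const K
    rw [zero_mul] at this
    exact this.eventually_lt_const (half_pos hα)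
  refine ⟨α / 2, half_pos hα, ?_⟩
  filter_upwards [small, self_mem_nhdsWithin] with t ht ht_pos
  filter_upwards [hcoercive.eventually, hD, D.2.2.1] with z hz hDz hermitian
  have norm_le : ‖-(t • D.1 z)‖ ≤ α / 2 := by
    rw [norm_neg, norm_smul, Real.norm_of_nonneg ht_pos.le]
    exact (mul_le_mul_of_nonneg_left hDz ht_pos.le).trans ht.le
  have posSemidef := posSemidef_smul_one_sub (hermitian.smul (.all t)).neg norm_le
  convert hz.add_posSemidef posSemidef using 1
  have halves : (α : ℂ) = ((α / 2 : ℝ) : ℂ) + ((α / 2 : ℝ) : ℂ) := by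
    rw [← Complex.ofReal_add, add_halves]
  rw [halves, add_smul, Pi.add_apply, Pi.smul_apply]
  abel

/-- The inner product `∫ tr (F K)` of perturbations of spectral densities; functions that agree
almost everywhere are not identified, so it is only semidefinite. -/
def traceForm (m : ℕ) : LinearMap.BilinForm ℝ (perturbationSpace m) :=
  LinearMap.mk₂ ℝ
    (fun F K => ∫ θ, (F.1 (Circle.exp θ) * K.1 (Circle.exp θ)).trace.re ∂angleMeasure)
    (fun F F' K => by
      rw [← integral_add (F.2.1.mul K.2.1).integrable_re_trace
        (F'.2.1.mul K.2.1).integrable_re_trace]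
      simp only [Submodule.coe_add, Pi.add_apply, add_mul, Matrix.trace_add, Complex.add_re])
    (fun c F K => by
      rw [smul_eq_mul, ← integral_const_mul]
      simp only [Submodule.coe_smul, Pi.smul_apply, smul_mul_assoc, Matrix.trace_smul,
        Complex.smul_re, smul_eq_mul])
    (fun F K K' => by
      rw [← integral_add (F.2.1.mul K.2.1).integrable_re_trace
        (F.2.1.mul K'.2.1).integrable_re_trace]
      simp only [Submodule.coe_add, Pi.add_apply, mul_add, Matrix.trace_add, Complex.add_re])
    (fun c F K => by
      rw [smul_eq_mul, ← integral_const_mul]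
      simp only [Submodule.coe_smul, Pi.smul_apply, mul_smul_comm, Matrix.trace_smul,
        Complex.smul_re, smul_eq_mul])

theorem traceForm_apply (F K : perturbationSpace m) : traceForm m F K =
    ∫ θ, (F.1 (Circle.exp θ) * K.1 (Circle.exp θ)).trace.re ∂angleMeasure := rfl

theorem trace_mul_self_nonneg (F : perturbationSpace m) :
    ∀ᶠ z in aeCircle, 0 ≤ (F.1 z * F.1 z).trace := by
  filter_upwards [F.2.2.1] with z hz
  simpa only [hz.eq] using (Matrix.posSemidef_conjTranspose_mul_self (F.1 z)).trace_nonneg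

theorem re_trace_mul_self_nonneg (F : perturbationSpace m) :
    ∀ᶠ z in aeCircle, 0 ≤ (F.1 z * F.1 z).trace.re :=
  (trace_mul_self_nonneg F).mono fun _ h => (Complex.nonneg_iff.1 h).1

theorem traceForm_isPosSemidef : (traceForm m).IsPosSemidef where
  eq F K := by
    simp only [traceForm_apply, Matrix.trace_mul_comm (F.1 _)]
  nonneg F := integral_nonneg_of_ae (re_trace_mul_self_nonneg F)

theorem eventually_eq_zero_of_traceForm_self {F : perturbationSpace m} (h : traceForm m F F = 0) :
    ∀ᶠ z in aeCircle, F.1 z = 0 := by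
  rw [traceForm_apply, integral_eq_zero_iff_of_nonneg_ae (re_trace_mul_self_nonneg F)
    (F.2.1.mul F.2.1).integrable_re_trace] at h
  have re_trace_eq : ∀ᶠ z in aeCircle, (F.1 z * F.1 z).trace.re = 0 := h
  filter_upwards [re_trace_eq, trace_mul_self_nonneg F, F.2.2.1] with z hre hnonneg hz
  rw [← Matrix.trace_conjTranspose_mul_self_eq_zero_iff, hz.eq]
  exact Complex.ext hre (Complex.nonneg_iff.1 hnonneg).2.symm

end Perturbations

/-! ## First-order optimality -/

section FirstVariation

open Filter
open scoped Matrix.Norms.L2Operator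

variable {m : ℕ} {Φ Ψ : Circle → Matrix (Fin m) (Fin m) ℂ}

theorem integral_inv_sub_inv_mul_nonpos (hΦ : IsSpectralDensity Φ) (hΨ : IsSpectralDensity Ψ)
    {D : Circle → Matrix (Fin m) (Fin m) ℂ} {t : ℝ} (ht : 0 < t)
    (hΦD : IsSpectralDensity (Φ + t • D)) (hle : rerDist Φ Ψ ≤ rerDist (Φ + t • D) Ψ) :
    ∫ θ, ((((Φ + t • D) (Circle.exp θ))⁻¹ - (Ψ (Circle.exp θ))⁻¹) *
      D (Circle.exp θ)).trace.re ∂angleMeasure ≤ 0 := by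
  have integral_nonneg := (sub_nonneg.2 hle).trans (rerDist_sub_le hΦ hΦD hΨ)
  have integrand_eq (θ : ℝ) : ((((Φ + t • D) (Circle.exp θ))⁻¹ - (Ψ (Circle.exp θ))⁻¹) *
      (Φ (Circle.exp θ) - (Φ + t • D) (Circle.exp θ))).trace.re =
      -t * ((((Φ + t • D) (Circle.exp θ))⁻¹ - (Ψ (Circle.exp θ))⁻¹) *
        D (Circle.exp θ)).trace.re := by
    rw [Pi.add_apply, sub_add_cancel_left, Pi.smul_apply, ← neg_smul, mul_smul_comm,
      Matrix.trace_smul, Complex.smul_re, smul_eq_mul]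
  simp_rw [integrand_eq] at integral_nonneg
  rw [integral_const_mul, neg_mul, mul_neg, neg_nonneg] at integral_nonneg
  exact nonpos_of_mul_nonpos_right (nonpos_of_mul_nonpos_right integral_nonneg (by positivity)) ht

theorem tendsto_integral_inv_add_smul (hΦ : IsSpectralDensity Φ) (hΨ : IsSpectralDensity Ψ)
    (D : perturbationSpace m) :
    Tendsto (fun t : ℝ => ∫ θ, ((((Φ + t • D.1) (Circle.exp θ))⁻¹ - (Ψ (Circle.exp θ))⁻¹) *
      D.1 (Circle.exp θ)).trace.re ∂angleMeasure) (nhdsWithin 0 (Set.Ioi 0))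
    (nhds (∫ θ, (((Φ (Circle.exp θ))⁻¹ - (Ψ (Circle.exp θ))⁻¹) *
      D.1 (Circle.exp θ)).trace.re ∂angleMeasure)) := by
  obtain ⟨α, hα, hposDef⟩ := hΦ.exists_eventually_posDef_add_smul D
  obtain ⟨K, -, hD⟩ := D.2.1.exists_norm_le
  obtain ⟨L, -, hL⟩ := hΨ.isEssBounded_inv.exists_norm_le
  have mem_perturbationSpace (t : ℝ) : Φ + t • D.1 ∈ perturbationSpace m :=
    add_mem hΦ.mem_perturbationSpace (Submodule.smul_mem _ t D.2)
  refine tendsto_integral_re_trace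
    (F := fun t z => (((Φ + t • D.1) z)⁻¹ - (Ψ z)⁻¹) * D.1 z)
    (K := fun z => ((Φ z)⁻¹ - (Ψ z)⁻¹) * D.1 z)
    (C := (‖((α : ℂ) • (1 : Matrix (Fin m) (Fin m) ℂ))⁻¹‖ + L) * K) ?_ ?_ ?_
  · filter_upwards [hposDef] with t ht
    exact (((mem_perturbationSpace t).1.inv hα ht).sub hΨ.isEssBounded_inv).mul D.2.1
  · filter_upwards [hposDef] with t ht
    filter_upwards [ht, hL, hD] with z hz hLz hDz
    have norm_sub_le := (norm_sub_le _ _).trans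
      (add_le_add (norm_inv_le_of_sub_smul_one_posDef hα hz) hLz)
    exact (Matrix.l2_opNorm_mul _ _).trans
      (mul_le_mul norm_sub_le hDz (norm_nonneg _) ((norm_nonneg _).trans norm_sub_le))
  · filter_upwards [hΦ.posDef] with z hz
    have tendsto_add_smul :
        Tendsto (fun t : ℝ => Φ z + t • D.1 z) (nhdsWithin 0 (Set.Ioi 0)) (nhds (Φ z)) := by
      have : Continuous fun t : ℝ => Φ z + t • D.1 z := by fun_prop
      simpa only [zero_smul, add_zero] using (this.tendsto 0).mono_left nhdsWithin_le_nhds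
    have continuousAt_inv : ContinuousAt Inv.inv (Φ z) :=
      continuousAt_matrix_inv _ (NormedRing.inverse_continuousAt hz.det_pos.ne'.isUnit.unit)
    exact ((continuousAt_inv.tendsto.comp tendsto_add_smul).sub_const _).mul_const _

theorem traceForm_inv_sub_inv_nonpos (hΦ : IsSpectralDensity Φ) (hΨ : IsSpectralDensity Ψ)
    (D : perturbationSpace m)
    (hmin : ∀ t : ℝ, IsSpectralDensity (Φ + t • D.1) → rerDist Φ Ψ ≤ rerDist (Φ + t • D.1) Ψ) :
    traceForm m (⟨_, hΦ.inv_mem_perturbationSpace⟩ - ⟨_, hΨ.inv_mem_perturbationSpace⟩) D ≤ 0 := by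
  obtain ⟨α, hα, hposDef⟩ := hΦ.exists_eventually_posDef_add_smul D
  refine le_of_tendsto (tendsto_integral_inv_add_smul hΦ hΨ D) ?_
  filter_upwards [hposDef, self_mem_nhdsWithin] with t ht ht_pos
  have hΦD : IsSpectralDensity (Φ + t • D.1) :=
    isSpectralDensity_of_mem_perturbationSpace
      (add_mem hΦ.mem_perturbationSpace (Submodule.smul_mem _ t D.2)) hα ht
  exact integral_inv_sub_inv_mul_nonpos hΦ hΨ ht_pos hΦD (hmin t hΦD)

end FirstVariation

/-! ## The adjoint of the moment map -/

section Moments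

open Filter
open scoped Matrix.Norms.L2Operator

theorem circleMean_add {f g : Circle → ℂ}
    (hf : Integrable (fun θ => f (Circle.exp θ)) angleMeasure)
    (hg : Integrable (fun θ => g (Circle.exp θ)) angleMeasure) :
    circleMean (fun z => f z + g z) = circleMean f + circleMean g := by
  simp only [circleMean, intervalIntegral_neg_pi_pi]
  rw [integral_add hf hg, mul_add]

theorem circleMean_const_mul (c : ℂ) (f : Circle → ℂ) :
    circleMean (fun z => c * f z) = c * circleMean f := by
  simp only [circleMean, intervalIntegral.integral_const_mul]
  ring

theorem integral_im_eq_zero_of_map_inv {f : Circle → ℂ}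
    (h : ∀ᶠ z in aeCircle, f z⁻¹ = starRingEnd ℂ (f z)) :
    ∫ θ, (f (Circle.exp θ)).im ∂angleMeasure = 0 := by
  have odd : ∫ θ, (f (Circle.exp (-θ))).im ∂angleMeasure =
      -∫ θ, (f (Circle.exp θ)).im ∂angleMeasure := by
    have im_eq : ∀ᶠ z in aeCircle, (f z⁻¹).im = -(f z).im := by
      filter_upwards [h] with z hz
      rw [hz, Complex.conj_im]
    simp only [← integral_neg, Circle.exp_neg, integral_congr_aeCircle im_eq]
  have even : ∫ θ, (f (Circle.exp (-θ))).im ∂angleMeasure =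
      ∫ θ, (f (Circle.exp θ)).im ∂angleMeasure := by
    rw [← intervalIntegral_neg_pi_pi, ← intervalIntegral_neg_pi_pi,
      intervalIntegral.integral_comp_neg fun θ => (f (Circle.exp θ)).im, neg_neg]
  linarith

theorem circleMean_eq_zero {f : Circle → ℂ}
    (hf : Integrable (fun θ => f (Circle.exp θ)) angleMeasure)
    (hre : ∫ θ, (f (Circle.exp θ)).re ∂angleMeasure = 0)
    (him : ∫ θ, (f (Circle.exp θ)).im ∂angleMeasure = 0) : circleMean f = 0 := by
  have integral_eq_zero : ∫ θ, f (Circle.exp θ) ∂angleMeasure = 0 :=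
    Complex.ext ((integral_re hf).symm.trans hre) ((integral_im hf).symm.trans him)
  rw [circleMean, intervalIntegral_neg_pi_pi, integral_eq_zero, mul_zero]

variable {n m : ℕ} {G : Circle → Matrix (Fin n) (Fin m) ℂ}

theorem momentAdjoint_mem_perturbationSpace (hG : IsEssBounded G)
    (hr : ∀ᶠ z in aeCircle, G z⁻¹ = (G z).map (starRingEnd ℂ)) (Λ : Matrix (Fin n) (Fin n) ℝ) :
    (fun z => (G z)ᴴ * (Λ + Λᵀ).map Complex.ofReal * G z) ∈ perturbationSpace m := by
  refine ⟨(hG.conjTranspose.mul (isEssBounded_const _)).mul hG, .of_forall fun z => ?_, ?_⟩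
  · have isHermitian : ((Λ + Λᵀ).map Complex.ofReal).IsHermitian :=
      (Matrix.isHermitian_add_transpose_self Λ).map _ fun x => (Complex.conj_ofReal x).symm
    exact Matrix.isHermitian_conjTranspose_mul_mul _ isHermitian
  · filter_upwards [hr] with z hz
    have map_conj_ofReal : ((Λ + Λᵀ).map Complex.ofReal).map (starRingEnd ℂ) =
        (Λ + Λᵀ).map Complex.ofReal :=
      Matrix.ext fun _ _ => Complex.conj_ofReal _
    rw [hz, Matrix.map_mul, Matrix.map_mul, map_conj_ofReal]
    rfl

/-- The adjoint `Λ ↦ G* (Λ + Λᵀ) G` of the moment map `Φ ↦ ∫ G Φ G*`. Symmetrizing `Λ` makes it a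
linear map on all real matrices. -/
def momentAdjoint (hG : IsEssBounded G)
    (hr : ∀ᶠ z in aeCircle, G z⁻¹ = (G z).map (starRingEnd ℂ)) :
    Matrix (Fin n) (Fin n) ℝ →ₗ[ℝ] perturbationSpace m where
  toFun Λ := ⟨_, momentAdjoint_mem_perturbationSpace hG hr Λ⟩
  map_add' Λ M := by
    ext1
    funext z
    simp only [Submodule.coe_add, Pi.add_apply, ← Matrix.add_mul, ← Matrix.mul_add,
      ← Matrix.map_add _ Complex.ofReal_add, Matrix.transpose_add]
    rw [add_add_add_comm]
  map_smul' c Λ := by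
    ext1
    funext z
    have map_smul : (c • Λ + (c • Λ)ᵀ).map Complex.ofReal = c • (Λ + Λᵀ).map Complex.ofReal := by
      rw [Matrix.transpose_smul, ← smul_add]
      exact Matrix.ext fun _ _ => Complex.ofReal_mul _ _
    simp only [map_smul, Matrix.mul_smul, Matrix.smul_mul, RingHom.id_apply, Submodule.coe_smul,
      Pi.smul_apply]

theorem momentAdjoint_apply (hG : IsEssBounded G)
    (hr : ∀ᶠ z in aeCircle, G z⁻¹ = (G z).map (starRingEnd ℂ)) (Λ : Matrix (Fin n) (Fin n) ℝ)
    (z : Circle) :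
    (momentAdjoint hG hr Λ).1 z = (G z)ᴴ * (Λ + Λᵀ).map Complex.ofReal * G z := rfl

theorem re_trace_mul_single_add_transpose {N : Matrix (Fin n) (Fin n) ℂ} (hN : N.IsHermitian)
    (i j : Fin n) :
    (N * (Matrix.single i j (1 : ℝ) + (Matrix.single i j 1)ᵀ).map Complex.ofReal).trace.re =
      2 * (N i j).re := by
  have re_symm : (N j i).re = (N i j).re := by
    rw [← hN.apply i j, Complex.star_def, Complex.conj_re]
  have map_single (i j : Fin n) : (Matrix.single i j (1 : ℝ)).map Complex.ofReal =
      Matrix.single i j 1 := by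
    rw [← Complex.ofReal_one]
    exact Matrix.map_single _ _ _ Complex.ofRealHom
  rw [Matrix.transpose_single, Matrix.map_add _ Complex.ofReal_add, map_single, map_single,
    Matrix.mul_add, Matrix.trace_add, Matrix.trace_mul_single, Matrix.trace_mul_single,
    MulOpposite.op_one, one_smul, one_smul, Complex.add_re, re_symm, two_mul]

theorem circleMean_eq_zero_of_orthogonal (hG : IsEssBounded G)
    (hr : ∀ᶠ z in aeCircle, G z⁻¹ = (G z).map (starRingEnd ℂ)) {D : perturbationSpace m}
    (hD : ∀ Λ, traceForm m D (momentAdjoint hG hr Λ) = 0) (i j : Fin n) :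
    circleMean (fun z => (G z * D.1 z * (G z)ᴴ) i j) = 0 := by
  have re_eq_zero : ∫ θ, ((G (Circle.exp θ) * D.1 (Circle.exp θ) * (G (Circle.exp θ))ᴴ) i j).re
      ∂angleMeasure = 0 := by
    have trace_eq : ∀ᶠ z in aeCircle,
        (D.1 z * (momentAdjoint hG hr (Matrix.single i j 1)).1 z).trace.re =
          2 * ((G z * D.1 z * (G z)ᴴ) i j).re := by
      filter_upwards [D.2.2.1] with z hz
      rw [← re_trace_mul_single_add_transpose (Matrix.isHermitian_mul_mul_conjTranspose _ hz),
        momentAdjoint_apply, ← Matrix.mul_assoc, Matrix.trace_mul_comm, ← Matrix.mul_assoc,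
        ← Matrix.mul_assoc]
    have orthogonal := hD (Matrix.single i j 1)
    rw [traceForm_apply, integral_congr_aeCircle trace_eq,
      integral_const_mul] at orthogonal
    exact (mul_eq_zero.1 orthogonal).resolve_left two_ne_zero
  have real : ∀ᶠ z in aeCircle, (G z⁻¹ * D.1 z⁻¹ * (G z⁻¹)ᴴ) i j =
      starRingEnd ℂ ((G z * D.1 z * (G z)ᴴ) i j) := by
    filter_upwards [hr, D.2.2.2] with z hGz hDz
    have map_conj : (G z * D.1 z * (G z)ᴴ).map (starRingEnd ℂ) =
        G z⁻¹ * D.1 z⁻¹ * (G z⁻¹)ᴴ := by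
      rw [hGz, hDz, Matrix.map_mul, Matrix.map_mul]
      rfl
    rw [← map_conj, Matrix.map_apply]
  have integrable := ((hG.mul D.2.1).mul hG.conjTranspose).integrable_apply i j
  have im_eq_zero := integral_im_eq_zero_of_map_inv
    (f := fun z => (G z * D.1 z * (G z)ᴴ) i j) real
  exact circleMean_eq_zero integrable re_eq_zero im_eq_zero

end Moments

/-! ## Existence of the multiplier -/

section Multiplier

open Filter
open scoped Matrix.Norms.L2Operator

variable {n m : ℕ} {G : Circle → Matrix (Fin n) (Fin m) ℂ}

theorem MomentConstraint.add_smul {S : Matrix (Fin n) (Fin n) ℝ}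
    {Φ D : Circle → Matrix (Fin m) (Fin m) ℂ} (h : MomentConstraint G S Φ) (hG : IsEssBounded G)
    (hΦ : IsEssBounded Φ) (hD : IsEssBounded D)
    (hmoment : ∀ i j, circleMean (fun z => (G z * D z * (G z)ᴴ) i j) = 0) (t : ℝ) :
    MomentConstraint G S (Φ + t • D) := by
  intro i j
  have integrand_eq (z : Circle) : (G z * (Φ + t • D) z * (G z)ᴴ) i j =
      (G z * Φ z * (G z)ᴴ) i j + t * (G z * D z * (G z)ᴴ) i j := by
    rw [Pi.add_apply, Pi.smul_apply, Matrix.mul_add, Matrix.add_mul, Matrix.mul_smul,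
      Matrix.smul_mul, Matrix.add_apply, Matrix.smul_apply, Complex.real_smul]
  have integrable {F : Circle → Matrix (Fin m) (Fin m) ℂ} (hF : IsEssBounded F) :=
    ((hG.mul hF).mul hG.conjTranspose).integrable_apply i j
  simp_rw [integrand_eq]
  rw [circleMean_add (integrable hΦ) ((integrable hD).const_mul _), circleMean_const_mul,
    hmoment, h, mul_zero, add_zero]

/-- The projection of `Φ⁻¹ - Ψ⁻¹` onto the orthogonal complement of the range of `momentAdjoint` is
a feasible direction, so the optimality of `Φ` forces it to vanish. -/
theorem IsOptimalApproximant.exists_inv_eq {S : Matrix (Fin n) (Fin n) ℝ}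
    {Ψ Φ : Circle → Matrix (Fin m) (Fin m) ℂ} (h : IsOptimalApproximant G S Ψ Φ)
    (hΨ : IsSpectralDensity Ψ) (hG : IsEssBounded G)
    (hr : ∀ᶠ z in aeCircle, G z⁻¹ = (G z).map (starRingEnd ℂ)) :
    ∃ Λ : Matrix (Fin n) (Fin n) ℝ, Λ.IsSymm ∧
      ∀ᶠ z in aeCircle, (Φ z)⁻¹ = inverseApproximant G Ψ Λ z := by
  let H : perturbationSpace m := ⟨_, h.spectral.inv_mem_perturbationSpace⟩ -
    ⟨_, hΨ.inv_mem_perturbationSpace⟩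
  obtain ⟨M, hM⟩ :=
    exists_forall_apply_sub_map_eq_zero traceForm_isPosSemidef (momentAdjoint hG hr) H
  let D := H - momentAdjoint hG hr M
  have variation_nonpos : traceForm m H D ≤ 0 :=
    traceForm_inv_sub_inv_nonpos h.spectral hΨ D fun t ht => h.minimal _ ht <|
      h.moment.add_smul hG h.spectral.isEssBounded D.2.1
        (circleMean_eq_zero_of_orthogonal hG hr hM) t
  have variation_eq : traceForm m H D = traceForm m D D := by
    rw [traceForm_isPosSemidef.isSymm.eq H D, ← sub_add_cancel H (momentAdjoint hG hr M), map_add,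
      hM, add_zero]
  have self_eq_zero : traceForm m D D = 0 :=
    le_antisymm (variation_eq ▸ variation_nonpos) (traceForm_isPosSemidef.nonneg D)
  refine ⟨M + Mᵀ, Matrix.isSymm_add_transpose_self M, ?_⟩
  filter_upwards [eventually_eq_zero_of_traceForm_self self_eq_zero] with z hz
  exact sub_eq_iff_eq_add'.1 (sub_eq_zero.1 hz)

theorem IsOptimalApproximant.exists_multiplier {S : Matrix (Fin n) (Fin n) ℝ}
    {Ψ Φ : Circle → Matrix (Fin m) (Fin m) ℂ} (h : IsOptimalApproximant G S Ψ Φ)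
    (hΨ : IsSpectralDensity Ψ) (hG : IsEssBounded G)
    (hr : ∀ᶠ z in aeCircle, G z⁻¹ = (G z).map (starRingEnd ℂ)) :
    ∃ Λ : Matrix (Fin n) (Fin n) ℝ, IsMultiplier G Ψ Λ ∧
      ∀ᶠ z in aeCircle, Φ z = approximant G Ψ Λ z := by
  obtain ⟨Λ, hΛ, hinv⟩ := h.exists_inv_eq hΨ hG hr
  refine ⟨Λ, ⟨hΛ, ?_⟩, ?_⟩
  · filter_upwards [hinv, h.spectral.posDef] with z hz hpos
    exact hz ▸ hpos.inv
  · filter_upwards [hinv, h.spectral.posDef] with z hz hpos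
    rw [approximant, ← hz, Matrix.nonsing_inv_nonsing_inv _ hpos.det_pos.ne'.isUnit]

end Multiplier

/-! ## The transfer function on the unit circle -/

section TransferFunctionOnCircle

open Filter

theorem tendsto_inv_aeCircle : Tendsto Inv.inv aeCircle aeCircle := by
  have neg_preimage : Neg.neg ⁻¹' Set.Ioc (-Real.pi) Real.pi = Set.Ico (-Real.pi) Real.pi := by
    rw [Set.neg_preimage, Set.neg_Ioc, neg_neg]
  have neg_preserving : MeasurePreserving Neg.neg angleMeasure angleMeasure := by
    have := (Measure.measurePreserving_neg (volume : Measure ℝ)).restrict_preimage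
      (measurableSet_Ioc (a := -Real.pi) (b := Real.pi))
    rwa [neg_preimage, Measure.restrict_congr_set Ico_ae_eq_Ioc] at this
  have exp_neg : Inv.inv ∘ Circle.exp = Circle.exp ∘ Neg.neg :=
    funext fun θ => (Circle.exp_neg θ).symm
  rw [aeCircle, tendsto_map'_iff, exp_neg]
  exact tendsto_map.comp neg_preserving.quasiMeasurePreserving.tendsto_ae

variable {n m : ℕ} {A : Matrix (Fin n) (Fin n) ℝ}

theorem isEssBounded_transferFunction
    (hA : ∀ a : ℂ, (A.map Complex.ofReal).charpoly.IsRoot a → ‖a‖ < 1)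
    (B : Matrix (Fin n) (Fin m) ℝ) : IsEssBounded (onCircle (transferFunction A B)) := by
  have continuous_sub : Continuous fun z : Circle =>
      Matrix.scalar (Fin n) (z : ℂ) - A.map Complex.ofReal :=
    (Continuous.matrix_diagonal (continuous_pi fun _ => continuous_subtype_val)).sub
      continuous_const
  have continuous_inv : Continuous fun z : Circle =>
      (Matrix.scalar (Fin n) (z : ℂ) - A.map Complex.ofReal)⁻¹ := by
    simp only [Matrix.inv_def, Ring.inverse_eq_inv']
    exact (continuous_sub.matrix_det.inv₀ fun z => ((Matrix.isUnit_iff_isUnit_det _).1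
      (isUnit_scalar_sub hA z.norm_coe.ge)).ne_zero).smul continuous_sub.matrix_adjugate
  refine IsEssBounded.congr ?_ ((onCircle_transferFunction hA B).mono fun z => Eq.symm)
  exact (isEssBounded_of_continuous continuous_inv).mul (isEssBounded_const _)

theorem onCircle_transferFunction_inv
    (hA : ∀ a : ℂ, (A.map Complex.ofReal).charpoly.IsRoot a → ‖a‖ < 1)
    (B : Matrix (Fin n) (Fin m) ℝ) : ∀ᶠ z in aeCircle, onCircle (transferFunction A B) z⁻¹ =
      (onCircle (transferFunction A B) z).map (starRingEnd ℂ) := by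
  have map_conj_ofReal {k : ℕ} (M : Matrix (Fin n) (Fin k) ℝ) :
      (M.map Complex.ofReal).map (starRingEnd ℂ) = M.map Complex.ofReal :=
    Matrix.ext fun _ _ => Complex.conj_ofReal _
  have values := onCircle_transferFunction hA B
  filter_upwards [values, tendsto_inv_aeCircle.eventually values] with z hz hz_inv
  rw [hz, hz_inv, Matrix.map_mul, map_conj_inv, Matrix.map_sub _ (map_sub _), map_conj_ofReal,
    map_conj_ofReal, Matrix.scalar_apply, Matrix.scalar_apply, Matrix.diagonal_map (map_zero _),
    Circle.coe_inv_eq_conj]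

end TransferFunctionOnCircle

end

theorem mainTheorem5_general {n m : ℕ} (A : Matrix (Fin n) (Fin n) ℝ) (B : Matrix (Fin n) (Fin m) ℝ)
    (hA : ∀ a : ℂ, (A.map Complex.ofReal).charpoly.IsRoot a → ‖a‖ < 1)
    (Ψ : Matrix (Fin m) (Fin m) (RatFunc ℂ)) (hΨ : IsSpectralDensity (onCircle Ψ)) :
    (Submodule.span ℝ
      (Set.range fun s : Fin n × Fin m => fun i => (A ^ (s.1 : ℕ) * B) i s.2) = ⊤ →
        mcmillanDegree (transferFunction A B) = n) ∧
    (∀ Λ : Matrix (Fin n) (Fin n) ℝ,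
      IsMultiplier (onCircle (transferFunction A B)) (onCircle Ψ) Λ →
        IsRationalOfDegreeLE (approximant (onCircle (transferFunction A B)) (onCircle Ψ) Λ)
          (mcmillanDegree Ψ + 2 * n)) ∧
    (∀ (S : Matrix (Fin n) (Fin n) ℝ) (Φ : Circle → Matrix (Fin m) (Fin m) ℂ),
      IsOptimalApproximant (onCircle (transferFunction A B)) S (onCircle Ψ) Φ →
        (∃ Λ : Matrix (Fin n) (Fin n) ℝ,
          IsMultiplier (onCircle (transferFunction A B)) (onCircle Ψ) Λ ∧
          AECircle fun z => Φ z =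
            approximant (onCircle (transferFunction A B)) (onCircle Ψ) Λ z) ∧
        IsRationalOfDegreeLE Φ (mcmillanDegree Ψ + 2 * n)) := by
  have hrat := fun Λ hΛ => isRationalOfDegreeLE_approximant (Λ := Λ) hA B
    (hΨ.posDef.mono fun _ h => h.isUnit) hΛ
  refine ⟨mcmillanDegree_transferFunction, hrat, fun S Φ hΦ => ?_⟩
  obtain ⟨Λ, hΛ, hΦΛ⟩ := hΦ.exists_multiplier hΨ (isEssBounded_transferFunction hA B)
    (onCircle_transferFunction_inv hA B)
  obtain ⟨P, hP, hdeg⟩ := hrat Λ hΛ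
  exact ⟨⟨Λ, hΛ, hΦΛ⟩, P, (hΦΛ.and hP.eventually).mono fun z hz => hz.1.trans hz.2, hdeg⟩

theorem mainTheorem5 {n m : ℕ} (A : Matrix (Fin n) (Fin n) ℝ) (B : Matrix (Fin n) (Fin m) ℝ)
    (hAB : IsFilterBank A B)
    (Ψ : Matrix (Fin m) (Fin m) (RatFunc ℂ)) (hΨ : IsSpectralDensity (onCircle Ψ)) :
    mcmillanDegree (transferFunction A B) = n ∧
    (∀ Λ : Matrix (Fin n) (Fin n) ℝ,
      IsMultiplier (onCircle (transferFunction A B)) (onCircle Ψ) Λ →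
        IsRationalOfDegreeLE (approximant (onCircle (transferFunction A B)) (onCircle Ψ) Λ)
          (mcmillanDegree Ψ + 2 * n)) ∧
    (∀ (S : Matrix (Fin n) (Fin n) ℝ) (Φ : Circle → Matrix (Fin m) (Fin m) ℂ), S.PosDef →
      IsOptimalApproximant (onCircle (transferFunction A B)) S (onCircle Ψ) Φ →
        (∃ Λ : Matrix (Fin n) (Fin n) ℝ,
          IsMultiplier (onCircle (transferFunction A B)) (onCircle Ψ) Λ ∧
          AECircle fun z => Φ z =
            approximant (onCircle (transferFunction A B)) (onCircle Ψ) Λ z) ∧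
        IsRationalOfDegreeLE Φ (mcmillanDegree Ψ + 2 * n)) := by
  obtain ⟨degree_eq, rational, optimal⟩ := mainTheorem5_general A B hAB.stable Ψ hΨ
  exact ⟨degree_eq hAB.reachable, rational, fun S Φ _ => optimal S Φ⟩
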